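/- Let $K$ be an algebraically closed field of characteristic zero, $V$ a $K$-vector space of finite dimension $k$, and $\mathfrak g\subset\mathfrak{sl}(V)$ a semisimple Lie subalgebra. Assume that $\mathfrak g$ contains an element $x$ which, as an endomorphism of $V$, is nilpotent with exactly one Jordan block. Let $n$ be the rank of $\mathfrak g$ and let $r_1,\dots,r_n$ be the exponents (listed with multiplicity) of the root system of $\mathfrak g$ with respect to a Cartan subalgebra $\mathfrak h$; that is, the algebra $S(\mathfrak h^*)^W$ of polynomial functions on $\mathfrak h$ invariant under the Weyl group $W$ is generated by $n$ algebraically independent homogeneous elements of degrees $r_1+1,\dots,r_n+1$. Then: (i) the exponents $r_1,\dots,r_n$ are pairwise distinct, and $r_i\le k-1$ for every $i$; (ii) if $r$ and $s$ are exponents of $\mathfrak g$ (possibly equal) with $r+s\le k$, then $r+s-1$ is also an exponent of $\mathfrak g$. -/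

import Mathlib

attribute [local instance 100] LieRing.ofAssociativeRing

/-- `x` is a nilpotent endomorphism of `V` with exactly one Jordan block: in some basis
`b 0, …, b d` of the (nonzero) space `V` its matrix is the Jordan block of size `d + 1` with
eigenvalue `0`, that is, `x (b 0) = 0` and `x (b (j + 1)) = b j`. -/
def IsSingleNilpotentJordanBlock {K V : Type*} [Field K] [AddCommGroup V] [Module K V]
    (x : Module.End K V) : Prop :=
  ∃ (d : ℕ) (b : Module.Basis (Fin (d + 1)) K V),
    LinearMap.toMatrix b b x =
      Matrix.of fun i j : Fin (d + 1) => if (i : ℕ) + 1 = (j : ℕ) then (1 : K) else 0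

/-- The algebra `S(M)^W` of invariants of the Weyl group `W` of a root system in the symmetric
algebra of its weight space `M`; an element `w` of `W` acts on `S(M)` by the algebra endomorphism
that extends its action on `M`. -/
noncomputable def RootPairing.weylInvariants {ι K M N : Type*} [Field K]
    [AddCommGroup M] [Module K M] [AddCommGroup N] [Module K N] (P : RootPairing ι K M N) :
    Subalgebra K (SymmetricAlgebra K M) :=
  ⨅ w : P.weylGroup, AlgHom.equalizer
    (SymmetricAlgebra.lift (SymmetricAlgebra.ι K M ∘ₗ P.weylGroupRootRep w))
    (AlgHom.id K (SymmetricAlgebra K M))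

/-- `r 0, …, r (n - 1)` are the exponents of the root system `P`, listed with multiplicity (in any
order): `n` is the rank, and the algebra of Weyl group invariants of `S(M)` is generated by `n`
algebraically independent homogeneous elements of degrees `r 0 + 1, …, r (n - 1) + 1`. The
homogeneous component of degree `d` of `S(M)` is the `d`-th power of the submodule `M`. -/
def RootPairing.IsExponents {ι K M N : Type*} [Field K]
    [AddCommGroup M] [Module K M] [AddCommGroup N] [Module K N] (P : RootPairing ι K M N)
    {n : ℕ} (r : Fin n → ℕ) : Prop :=
  n = Module.finrank K M ∧
  ∃ f : Fin n → SymmetricAlgebra K M,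
    AlgebraicIndependent K f ∧
    (∀ i, f i ∈ (LinearMap.range (SymmetricAlgebra.ι K M)) ^ (r i + 1)) ∧
    Algebra.adjoin K (Set.range f) = P.weylInvariants

/-! Let `d + 1 = dim V`, let `x` be the Jordan block, and let `E = powExponents g x d` be the set of
`r` in `1..d` with `x ^ r ∈ g`. The theorem follows once the exponents are shown to be exactly the
elements of `E`, each occurring once (`exists_equiv_powExponents`): part (i) is then immediate. For
part (ii), complete `x` to an `sl₂`-triple `h, x, y` in `g`; then `⁅⁅x ^ r, y⁆, x ^ s⁆` is a nonzero
multiple of `x ^ (r + s - 1)`.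

To identify the exponents, decompose `g` under the triple. The centralizer of `x` consists of
polynomials in `x`, so the strings `(ad y) ^ j (x ^ r)` give `∑ (2 r + 1) ≤ dim g` over `E`, and the
centralizer of `h` in `g` has dimension at most `|E|`. The trace form gives an equivariant
projection `p` onto `g`, and the `p (h ^ r)`, `r ∈ E`, form a basis of that centralizer with nonzero
Gram determinant. An adjoint-invariant polynomial on `g` that vanishes on a Cartan subalgebra `H` is
zero; hence some `c ∈ H` also has a nonzero Gram determinant, and `|E| = dim H`.

It follows that the functions `tr (z ^ (r + 1))` on `H`, `r ∈ E`, have nonzero Jacobian. They are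
Weyl invariant, hence polynomials in the basic invariants; the chain rule matches basic invariants
with elements of `E` so that each exponent is at most its partner. Conversely, the Jacobian of the
basic invariants vanishes on every mirror, so the number of roots is at most twice the sum of the
exponents. Therefore `dim g ≤ n + 2 ∑ rᵢ ≤ n + 2 ∑_E r ≤ dim g`, and every inequality is an
equality. -/

namespace LieSubalgebra

/-! ### The trace form and the projection onto `g` -/

variable {K V : Type*} [Field K] [CharZero K] [AddCommGroup V] [Module K V]
  [FiniteDimensional K V]

/-- The trace form of a semisimple linear Lie algebra is nondegenerate. -/
theorem eq_zero_of_forall_trace_mul_eq_zero (g : LieSubalgebra K (Module.End K V))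
    [LieAlgebra.IsSemisimple K g] (z : g)
    (hz : ∀ w : g, LinearMap.trace K V ((z : Module.End K V) * w) = 0) : z = 0 := by
  have hform : ∀ a b : g, LieModule.traceForm K g V a b =
      LinearMap.trace K V ((a : Module.End K V) * b) := fun a b => rfl
  let I : LieIdeal K g :=
    { LinearMap.ker (LieModule.traceForm K g V) with
      lie_mem := by
        intro x m hm
        simp only [AddSubsemigroup.mem_carrier, AddSubmonoid.mem_toSubsemigroup,
          Submodule.mem_toAddSubmonoid, LinearMap.mem_ker] at hm ⊢
        ext w
        rw [LieModule.traceForm_comm, ← LieModule.traceForm_apply_lie_apply,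
          LieModule.traceForm_comm, hm]
        rfl }
  have hI : ∀ a, a ∈ I ↔ LieModule.traceForm K g V a = 0 := fun a => Iff.rfl
  have h0 : LieModule.traceForm K I V = 0 := by
    ext a b
    have := (hI a).1 a.2
    exact LinearMap.congr_fun this (b : g)
  -- Cartan's criterion: on the radical `I` of the form the trace form is zero, so the derived ideal
  -- of `I` acts nilpotently on `V`. Hence `I` is solvable and lies in the zero radical of `g`.
  have hnil := LieModule.isNilpotent_derivedSeries_of_traceForm_eq_zero h0
  have hsolv : LieAlgebra.IsSolvable I := by
    have hD : LieRing.IsNilpotent (LieAlgebra.derivedSeries K I 1) := by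
      rw [LieAlgebra.isNilpotent_iff_forall (R := K)]
      intro x
      have hx := (LieModule.isNilpotent_iff_forall' (R := K)).1 hnil x
      have hx' : IsNilpotent (((x : I) : g) : Module.End K V) := hx
      have h1 := LieAlgebra.isNilpotent_ad_of_isNilpotent (R := K) (x := ((x : I) : g)) hx'
      have h2 : IsNilpotent (LieAlgebra.ad K I (x : I)) :=
        LieSubalgebra.isNilpotent_ad_of_isNilpotent_ad (I : LieSubalgebra K g) (x := (x : I)) h1
      exact LieSubalgebra.isNilpotent_ad_of_isNilpotent_ad
        ((LieAlgebra.derivedSeries K I 1 : LieIdeal K I) : LieSubalgebra K I) (x := x) h2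
    obtain ⟨k, hk⟩ := LieAlgebra.IsSolvable.solvable K (LieAlgebra.derivedSeries K I 1)
    rw [LieIdeal.derivedSeries_eq_bot_iff] at hk
    refine LieAlgebra.IsSolvable.mk (R := K) (k := k + 1) ?_
    rw [LieAlgebra.derivedSeries_def, LieAlgebra.derivedSeriesOfIdeal_add]
    exact hk
  have : I ≤ LieAlgebra.radical K g := (LieAlgebra.LieIdeal.solvable_iff_le_radical K g I).1 hsolv
  rw [LieAlgebra.HasTrivialRadical.radical_eq_bot] at this
  have hzI : z ∈ I := (hI z).2 (by ext w; exact hz w)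
  simpa using this hzI

/-- The orthogonal projection onto a semisimple linear Lie algebra. -/
theorem exists_projection (g : LieSubalgebra K (Module.End K V))
    [LieAlgebra.IsSemisimple K g] : ∃ p : Module.End K V →ₗ[K] g, ∀ a (w : g),
      LinearMap.trace K V ((p a : Module.End K V) * w) = LinearMap.trace K V (a * w) := by
  let T : Module.End K V →ₗ[K] Module.Dual K g :=
    ((LinearMap.mul K (Module.End K V)).compr₂ (LinearMap.trace K V)).compl₂
      (g.toSubmodule.subtype)
  have hT : ∀ a w, T a w = LinearMap.trace K V (a * (w : g)) := fun a w => rfl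
  let B : g →ₗ[K] Module.Dual K g := T ∘ₗ g.toSubmodule.subtype
  have hB : Function.Injective B := by
    rw [← LinearMap.ker_eq_bot, LinearMap.ker_eq_bot']
    intro z hz
    exact g.eq_zero_of_forall_trace_mul_eq_zero z fun w => LinearMap.congr_fun hz w
  let e : g ≃ₗ[K] Module.Dual K g :=
    LinearEquiv.ofInjectiveOfFinrankEq B hB (Subspace.dual_finrank_eq).symm
  refine ⟨e.symm.toLinearMap ∘ₗ T, fun a w => ?_⟩
  have : B (e.symm (T a)) = T a := e.apply_symm_apply (T a)
  exact LinearMap.congr_fun this w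

section Projection

variable {g : LieSubalgebra K (Module.End K V)} [LieAlgebra.IsSemisimple K g]
  {p : Module.End K V →ₗ[K] g}
  (hp : ∀ a (w : g),
    LinearMap.trace K V ((p a : Module.End K V) * w) = LinearMap.trace K V (a * w))
include hp

theorem projection_eq (a : Module.End K V) (z : g)
    (h : ∀ w : g, LinearMap.trace K V (a * w) =
      LinearMap.trace K V ((z : Module.End K V) * w)) : p a = z := by
  rw [← sub_eq_zero]
  refine g.eq_zero_of_forall_trace_mul_eq_zero _ fun w => ?_
  simp [sub_mul, hp, h]

theorem projection_coe (z : g) : p z = z := projection_eq hp _ _ fun _ => rfl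

theorem projection_of_mem {z : Module.End K V} (hz : z ∈ g) :
    (p z : Module.End K V) = z := congrArg _ (projection_coe hp ⟨z, hz⟩)

/-- Invariance of the trace form makes the orthogonal projection equivariant under `g`. This is what
allows relations with `x`, `h`, `y` to be pushed into `g`. -/
theorem projection_lie (u : g) (a : Module.End K V) : p ⁅(u : Module.End K V), a⁆ = ⁅u, p a⁆ := by
  refine projection_eq hp _ _ fun w => ?_
  have h1 := hp a ⁅w, u⁆
  simp only [LieSubalgebra.coe_bracket, Ring.lie_def, mul_sub, sub_mul, map_sub] at h1 ⊢
  have c : ∀ a b c : Module.End K V, LinearMap.trace K V (a * b * c) =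
      LinearMap.trace K V (b * (c * a)) := fun a b c => by
    rw [mul_assoc, LinearMap.trace_mul_comm, mul_assoc]
  rw [c, c (u : Module.End K V), mul_assoc, mul_assoc, h1]

end Projection

end LieSubalgebra

/-! ### Endomorphisms with a single nilpotent Jordan block -/

section CyclicNilpotent

open Module

variable {K V : Type*} [Field K] [AddCommGroup V] [Module K V] {d : ℕ} {x : Module.End K V}
  {v : V}

/-- If `x ^ (d + 1) = 0` and `x ^ d v ≠ 0`, where `d + 1 = dim V`, then `v, x v, …, x ^ d v` is a
basis of `V`. -/
theorem exists_basis_pow_apply (hV : finrank K V = d + 1) (hx : x ^ (d + 1) = 0)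
    (hv : (x ^ d) v ≠ 0) : ∃ e : Basis (Fin (d + 1)) K V, ∀ i, e i = (x ^ (i : ℕ)) v := by
  classical
  have hli : LinearIndependent K fun i : Fin (d + 1) => (x ^ (i : ℕ)) v := by
    rw [Fintype.linearIndependent_iff]
    intro c hc
    by_contra! hne
    obtain ⟨i, hi⟩ := hne
    let S : Finset (Fin (d + 1)) := Finset.univ.filter fun i => c i ≠ 0
    have hS : S.Nonempty := ⟨i, by simp [S, hi]⟩
    let m := S.min' hS
    have hm : c m ≠ 0 := by
      have := S.min'_mem hS
      simpa [S] using this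
    have hlt : ∀ j < m, c j = 0 := fun j hj => by
      by_contra h
      exact absurd (S.min'_le j (by simp [S, h])) (not_le.2 hj)
    have h1 := congrArg (x ^ (d - (m : ℕ))) hc
    rw [map_sum, map_zero, Finset.sum_eq_single m] at h1
    · rw [map_smul, ← Module.End.mul_apply, ← pow_add, Nat.sub_add_cancel (by omega)] at h1
      exact (smul_ne_zero hm hv) h1
    · intro j _ hj
      rcases lt_or_gt_of_ne hj with h | h
      · simp [hlt j h]
      · rw [map_smul, ← Module.End.mul_apply, ← pow_add,
          pow_eq_zero_of_le (by have : (m : ℕ) < j := h; omega) hx]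
        simp
    · simp
  have hcard : Fintype.card (Fin (d + 1)) = finrank K V := by simp [hV]
  exact ⟨basisOfLinearIndependentOfCardEqFinrank hli hcard, fun i => by simp⟩

theorem IsSingleNilpotentJordanBlock.exists_pow (hx : IsSingleNilpotentJordanBlock x) :
    ∃ d v, finrank K V = d + 1 ∧ x ^ (d + 1) = 0 ∧ (x ^ d) v ≠ 0 := by
  obtain ⟨d, b, hb⟩ := hx
  have h0 : ∀ j : Fin (d + 1), x (b j) = ∑ i : Fin (d + 1), (if (i : ℕ) + 1 = j then (1 : K) else 0) • b i := by
    intro j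
    rw [← b.sum_repr (x (b j))]
    refine Finset.sum_congr rfl fun i _ => ?_
    have := congrFun (congrFun hb i) j
    rw [LinearMap.toMatrix_apply, Matrix.of_apply] at this
    rw [this]
  have h1 : ∀ (j : ℕ) (hj : j + 1 < d + 1), x (b ⟨j + 1, hj⟩) = b ⟨j, by omega⟩ := by
    intro j hj
    rw [h0, Finset.sum_eq_single ⟨j, by omega⟩]
    · simp
    · intro i _ hi
      have : (i : ℕ) ≠ j := fun h => hi (Fin.ext h)
      simp [this]
    · simp
  have h2 : x (b 0) = 0 := by
    rw [h0]
    simp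
  have h3 : ∀ (i j : ℕ) (hj : i + j < d + 1), (x ^ i) (b ⟨i + j, hj⟩) = b ⟨j, by omega⟩ := by
    intro i
    induction i with
    | zero => intro j hj; simp
    | succ i ih =>
      intro j hj
      rw [pow_succ, Module.End.mul_apply]
      have h4 : i + j + 1 < d + 1 := by omega
      have h5 : (⟨i + 1 + j, hj⟩ : Fin (d + 1)) = ⟨i + j + 1, h4⟩ := Fin.ext (by simp; omega)
      rw [h5, h1, ih]
  refine ⟨d, b ⟨d, by omega⟩, by simp [finrank_eq_card_basis b], b.ext fun j => ?_, ?_⟩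
  · have h4 := h3 j 0 (by omega)
    have h5 : (x ^ ((j : ℕ) + 1)) (b j) = 0 := by
      rw [pow_succ', Module.End.mul_apply]
      simp only [add_zero, Fin.eta] at h4
      rw [h4]
      exact h2
    have h6 : x ^ (d + 1) = x ^ (d - (j : ℕ)) * x ^ ((j : ℕ) + 1) := by
      rw [← pow_add]
      congr 1
      omega
    rw [h6, Module.End.mul_apply, h5]
    simp
  · have := h3 d 0 (by simp)
    simp only [add_zero] at this
    rw [this]
    exact b.ne_zero _

/-- The centralizer of a nilpotent endomorphism with cyclic vector `v` consists of the polynomials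
in it. -/
theorem eq_sum_pow_of_commute (e : Basis (Fin (d + 1)) K V) (he : ∀ i, e i = (x ^ (i : ℕ)) v)
    {m : Module.End K V} (hm : Commute m x) :
    ∃ c : Fin (d + 1) → K, m = ∑ i, c i • x ^ (i : ℕ) := by
  refine ⟨fun i => e.repr (m v) i, e.ext fun j => ?_⟩
  rw [he, ← Module.End.mul_apply, (hm.pow_right j).eq, Module.End.mul_apply]
  conv_lhs => rw [← e.sum_repr (m v)]
  simp only [LinearMap.sum_apply, LinearMap.smul_apply, map_sum, map_smul]
  refine Finset.sum_congr rfl fun i _ => ?_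
  rw [he, ← Module.End.mul_apply, ← Module.End.mul_apply, ← pow_add, ← pow_add,
    add_comm (i : ℕ)]

/-- The explicit model of the irreducible `sl₂`-module of dimension `d + 1`, with `v` as lowest
weight vector and `x` as raising operator. These operators need not lie in `g`. -/
theorem exists_weight_operators (hx : x ^ (d + 1) = 0) (e : Basis (Fin (d + 1)) K V)
    (he : ∀ i, e i = (x ^ (i : ℕ)) v) : ∃ h y : Module.End K V,
      (∀ i : ℕ, h ((x ^ i) v) = (2 * (i : K) - d) • (x ^ i) v) ∧
      ⁅h, x⁆ = (2 : K) • x ∧ ⁅x, y⁆ = h ∧ ⁅h, y⁆ = (-2 : K) • y := by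
  let h : Module.End K V := e.constr K fun i => (2 * ((i : ℕ) : K) - d) • e i
  let y : Module.End K V :=
    e.constr K fun i => (((i : ℕ) : K) * (d - (i : ℕ) + 1)) • (x ^ ((i : ℕ) - 1)) v
  have hh : ∀ i : ℕ, h ((x ^ i) v) = (2 * (i : K) - d) • (x ^ i) v := by
    intro i
    by_cases hi : i < d + 1
    · have : (x ^ i) v = e ⟨i, hi⟩ := by rw [he]
      rw [this]
      simp [h]
    · rw [pow_eq_zero_of_le (not_lt.1 hi) hx]
      simp
  have hy : ∀ i : ℕ, i ≤ d + 1 →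
      y ((x ^ i) v) = ((i : K) * (d - i + 1)) • (x ^ (i - 1)) v := by
    intro i hi'
    by_cases hi : i < d + 1
    · have : (x ^ i) v = e ⟨i, hi⟩ := by rw [he]
      rw [this]
      simp [y]
    · obtain rfl : i = d + 1 := by omega
      rw [hx]
      simp
  have hs : ∀ i : ℕ, x ((x ^ i) v) = (x ^ (i + 1)) v := fun i => by
    rw [pow_succ', Module.End.mul_apply]
  refine ⟨h, y, hh, e.ext fun i => ?_, e.ext fun i => ?_, e.ext fun i => ?_⟩
  · rw [he, Ring.lie_def]
    simp only [LinearMap.sub_apply, Module.End.mul_apply, LinearMap.smul_apply, hh, hs, map_smul]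
    rw [← sub_smul]
    congr 1
    push_cast
    ring
  · rw [he, Ring.lie_def]
    simp only [LinearMap.sub_apply, Module.End.mul_apply]
    rw [hh, hs, hy _ (by omega), hy _ (by omega), map_smul, hs]
    obtain hi | ⟨j, hj⟩ : (i : ℕ) = 0 ∨ ∃ j : ℕ, (i : ℕ) = j + 1 := by
      rcases Nat.eq_zero_or_pos (i : ℕ) with h | h
      · exact Or.inl h
      · exact Or.inr ⟨i - 1, by omega⟩
    · rw [hi]
      simp
    · rw [hj]
      simp only [Nat.add_sub_cancel]
      rw [← sub_smul]
      congr 1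
      push_cast
      ring
  · rw [he, Ring.lie_def]
    simp only [LinearMap.sub_apply, Module.End.mul_apply, LinearMap.smul_apply]
    rw [hh, hy _ (by omega), map_smul, map_smul, hh, hy _ (by omega)]
    obtain hi | ⟨j, hj⟩ : (i : ℕ) = 0 ∨ ∃ j : ℕ, (i : ℕ) = j + 1 := by
      rcases Nat.eq_zero_or_pos (i : ℕ) with h | h
      · exact Or.inl h
      · exact Or.inr ⟨i - 1, by omega⟩
    · rw [hi]
      simp
    · rw [hj]
      simp only [Nat.add_sub_cancel, smul_smul]
      rw [← sub_smul]
      congr 1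
      push_cast
      ring

theorem trace_pow_eq_zero (hx : x ^ (d + 1) = 0) {i : ℕ} (hi : i ≠ 0) :
    LinearMap.trace K V (x ^ i) = 0 := by
  have : IsNilpotent (x ^ i) := by
    refine ⟨d + 1, ?_⟩
    rw [← pow_mul, mul_comm, pow_mul, hx, zero_pow hi]
  exact (LinearMap.isNilpotent_trace_of_isNilpotent this).eq_zero

theorem lie_pow_of_lie {h : Module.End K V} (hhx : ⁅h, x⁆ = (2 : K) • x) (i : ℕ) :
    ⁅h, x ^ i⁆ = (2 * (i : K)) • x ^ i := by
  induction i with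
  | zero => simp [Ring.lie_def]
  | succ i ih =>
    rw [Ring.lie_def] at *
    have : h * x ^ (i + 1) - x ^ (i + 1) * h =
        (h * x ^ i - x ^ i * h) * x + x ^ i * (h * x - x * h) := by
      rw [pow_succ]; noncomm_ring
    rw [this, ih, hhx]
    rw [smul_mul_assoc, mul_smul_comm, ← pow_succ, ← add_smul]
    congr 1
    push_cast
    ring

end CyclicNilpotent

/-! ### An `sl₂`-triple inside `g` through `x` -/

namespace LieSubalgebra

open Module

variable {K V : Type*} [Field K] [CharZero K] [AddCommGroup V] [Module K V]
  [FiniteDimensional K V]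

/-- A semisimple linear Lie algebra that contains a cyclic nilpotent `x` contains an
`sl₂`-triple through `x`, whose semisimple element has the weights `-d, -d + 2, …, d`. -/
theorem exists_sl2_of_pow {g : LieSubalgebra K (Module.End K V)} [LieAlgebra.IsSemisimple K g]
    (hsl : ∀ a ∈ g, LinearMap.trace K V a = 0) {d : ℕ} {x : Module.End K V} (hxg : x ∈ g)
    {u : V} (hV : finrank K V = d + 1) (hx : x ^ (d + 1) = 0) (hu : (x ^ d) u ≠ 0) :
    ∃ (v : V) (e : Basis (Fin (d + 1)) K V) (h y : Module.End K V),
      (∀ i, e i = (x ^ (i : ℕ)) v) ∧ h ∈ g ∧ y ∈ g ∧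
      (∀ i : ℕ, h ((x ^ i) v) = (2 * (i : K) - d) • (x ^ i) v) ∧
      ⁅h, x⁆ = (2 : K) • x ∧ ⁅x, y⁆ = h ∧ ⁅h, y⁆ = (-2 : K) • y := by
  obtain ⟨p, hp⟩ := g.exists_projection
  obtain ⟨b, hb⟩ := exists_basis_pow_apply hV hx hu
  obtain ⟨h0, y0, hh0, hhx0, hxy0, -⟩ := exists_weight_operators hx b hb
  have hplie : ∀ {z : Module.End K V} (hz : z ∈ g) (a : Module.End K V),
      (p ⁅z, a⁆ : Module.End K V) = ⁅z, (p a : Module.End K V)⁆ := fun hz a => by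
    rw [projection_lie hp ⟨_, hz⟩ a, LieSubalgebra.coe_bracket]
  -- Projecting the model `h0` keeps the relation with `x`, because `p` is equivariant and fixes
  -- `x`. It remains to see that `h` has the same weights as `h0`, possibly on another cyclic
  -- vector.
  obtain ⟨h, hhdef⟩ : ∃ h : Module.End K V, h = ((p h0 : g) : Module.End K V) := ⟨_, rfl⟩
  have hhg : h ∈ g := hhdef ▸ (p h0).2
  have hhx : ⁅h, x⁆ = (2 : K) • x := by
    rw [← lie_skew, hhdef, ← hplie hxg, ← lie_skew, hhx0]
    simp [projection_of_mem hp hxg]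
  -- the lowest weight of `h`
  have hlow : ∃ c : Fin (d + 1) → K, h - h0 = ∑ i, c i • x ^ (i : ℕ) := by
    refine eq_sum_pow_of_commute b hb ?_
    have : ⁅h - h0, x⁆ = 0 := by rw [sub_lie, hhx, hhx0, sub_self]
    rwa [Ring.lie_def, sub_eq_zero] at this
  obtain ⟨c, hc⟩ := hlow
  have htr0 : LinearMap.trace K V h0 = 0 := by
    rw [← hxy0, Ring.lie_def, map_sub, LinearMap.trace_mul_comm, sub_self]
  -- Both `h` and `h0` are traceless and positive powers of `x` have trace zero, so no scalar term
  -- survives: `h - h0` is a polynomial in `x` without constant term.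
  have hc0 : c 0 = 0 := by
    have h1 := congrArg (LinearMap.trace K V) hc
    rw [map_sub, hsl h hhg, htr0, sub_zero, map_sum, Finset.sum_eq_single 0] at h1
    · simp only [Fin.val_zero, pow_zero, map_smul, LinearMap.trace_one, smul_eq_mul] at h1
      rw [hV] at h1
      have : ((d + 1 : ℕ) : K) ≠ 0 := Nat.cast_ne_zero.2 (by omega)
      exact (mul_eq_zero.1 h1.symm).resolve_right this
    · intro i _ hi
      rw [map_smul, trace_pow_eq_zero hx (fun h => hi (Fin.ext h)), smul_zero]
    · simp
  let W : Submodule K V := LinearMap.ker (x ^ d)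
  have hpow : ∀ (i : ℕ) (w : V), h ((x ^ i) w) = (x ^ i) (h w) + (2 * (i : K)) • (x ^ i) w := by
    intro i w
    have := LinearMap.congr_fun (lie_pow_of_lie hhx i) w
    rw [Ring.lie_def] at this
    simp only [LinearMap.sub_apply, Module.End.mul_apply, LinearMap.smul_apply] at this
    rw [← this]; abel
  have hu1 : h u + (d : K) • u ∈ W := by
    have h1 := LinearMap.congr_fun hc u
    rw [LinearMap.sub_apply, sub_eq_iff_eq_add] at h1
    have h2 := hh0 0
    simp only [Nat.cast_zero, mul_zero, zero_sub, pow_zero, Module.End.one_apply] at h2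
    rw [h1, h2, LinearMap.sum_apply]
    simp only [neg_smul, neg_add_cancel_right]
    refine Submodule.sum_mem _ fun i _ => ?_
    by_cases hi : i = 0
    · simp [hi, hc0]
    · refine Submodule.smul_mem _ _ ?_
      have : (i : ℕ) ≠ 0 := fun h => hi (Fin.ext h)
      rw [LinearMap.mem_ker, ← Module.End.mul_apply, ← pow_add,
        pow_eq_zero_of_le (by omega) hx, LinearMap.zero_apply]
  have htop : h ((x ^ d) u) = (d : K) • (x ^ d) u := by
    have h1 : (x ^ d) (h u + (d : K) • u) = 0 := hu1
    rw [map_add, map_smul, ← eq_neg_iff_add_eq_zero] at h1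
    rw [hpow, h1, ← neg_smul, ← add_smul]
    congr 1; ring
  have hker : ∀ w, x w = 0 → ∃ a : K, w = a • (x ^ d) u := by
    intro w hw
    have h1 : ∀ j : Fin (d + 1), (j : ℕ) < d → b.repr w j = 0 := by
      intro j hj
      have h2 : ∑ i : Fin (d + 1), b.repr w i • (x ^ ((i : ℕ) + 1)) u = 0 := by
        rw [← hw]
        conv_rhs => rw [← b.sum_repr w]
        rw [map_sum]
        refine Finset.sum_congr rfl fun i _ => ?_
        rw [map_smul, hb, pow_succ', Module.End.mul_apply]
      rw [Fin.sum_univ_castSucc] at h2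
      simp only [Fin.val_last, hx, LinearMap.zero_apply, smul_zero, add_zero] at h2
      have h3 : ∀ i : Fin d, (x ^ ((i.castSucc : ℕ) + 1)) u = b i.succ := by
        intro i; rw [hb]; rfl
      simp only [h3] at h2
      have hli : LinearIndependent K fun i : Fin d => b i.succ :=
        b.linearIndependent.comp _ (Fin.succ_injective d)
      have := Fintype.linearIndependent_iff.1 hli _ h2 ⟨j, hj⟩
      exact this
    refine ⟨b.repr w (Fin.last d), ?_⟩
    conv_lhs => rw [← b.sum_repr w]
    rw [Fin.sum_univ_castSucc, Finset.sum_eq_zero, zero_add, hb]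
    · simp
    · intro i _
      rw [h1 _ (by simp), zero_smul]
  have hWinv : ∀ w ∈ W, (h + (d : K) • (1 : Module.End K V)) w ∈ W := by
    intro w hw
    have hw' : (x ^ d) w = 0 := hw
    have h1 := hpow d w
    rw [hw'] at h1
    simp only [map_zero, smul_zero, add_zero] at h1
    change (x ^ d) _ = 0
    simp [hw', ← h1]
  let T : W →ₗ[K] W := (h + (d : K) • (1 : Module.End K V)).restrict hWinv
  -- On `W = ker (x ^ d)` the eigenvalue `-d` of `h` does not occur. If `h w = -d w` and `x ^ (m +
  -- 1) w = 0` with `m < d`, then `x ^ m w` has weight `2m - d` but lies in the line `ker x` of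
  -- weight `d`, so it is zero; descend to `m = 0`.
  have hTinj : Function.Injective T := by
    rw [← LinearMap.ker_eq_bot, LinearMap.ker_eq_bot']
    rintro ⟨w, hw⟩ hTw
    have h1 : h w = (-(d : K)) • w := by
      have h2 : (h + (d : K) • (1 : Module.End K V)) w = 0 := congrArg Subtype.val hTw
      simp only [LinearMap.add_apply, LinearMap.smul_apply, Module.End.one_apply] at h2
      rw [neg_smul, eq_neg_iff_add_eq_zero, h2]
    have key : ∀ i : ℕ, i ≤ d → (x ^ (d - i)) w = 0 := by
      intro i
      induction i with
      | zero => intro _; exact hw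
      | succ i ih =>
        intro hi
        have h3 := ih (by omega)
        obtain ⟨m, hm⟩ : ∃ m, d = m + (i + 1) := ⟨d - (i + 1), by omega⟩
        have e1 : d - i = m + 1 := by omega
        have e2 : d - (i + 1) = m := by omega
        rw [e1, pow_succ', Module.End.mul_apply] at h3
        obtain ⟨a, ha⟩ := hker _ h3
        have h4 := hpow m w
        rw [h1, map_smul, ← add_smul, ha, map_smul, htop, smul_comm, ← sub_eq_zero,
          ← sub_smul] at h4
        have h5 : (d : K) - (-(d : K) + 2 * (m : K)) ≠ 0 := by
          have : ((2 * (i + 1) : ℕ) : K) ≠ 0 := Nat.cast_ne_zero.2 (by omega)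
          intro h
          apply this
          rw [← h, hm]
          push_cast
          ring
        rw [e2, ha]
        exact (smul_eq_zero.1 h4).resolve_left h5
    have := key d le_rfl
    exact Subtype.ext (by simpa using this)
  have hTsurj : Function.Surjective T := LinearMap.injective_iff_surjective.1 hTinj
  obtain ⟨⟨w, hw⟩, hTw⟩ := hTsurj ⟨_, hu1⟩
  have hw2 : h w + (d : K) • w = h u + (d : K) • u := congrArg Subtype.val hTw
  -- Since `h + d` is invertible on `W`, the error `h u + d u ∈ W` can be removed by an element of
  -- `W`. The corrected vector is an exact lowest weight vector and still cyclic.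
  let v := u - w
  have hv : h v = (-(d : K)) • v := by
    have h1 : h u - h w = (d : K) • w - (d : K) • u := by
      rw [sub_eq_sub_iff_add_eq_add, ← hw2, add_comm]
    simp only [v, map_sub, h1, neg_smul, smul_sub]
    abel
  have hxv : (x ^ d) v ≠ 0 := by
    have hw' : (x ^ d) w = 0 := hw
    simpa [v, hw'] using hu
  obtain ⟨e, he⟩ := exists_basis_pow_apply hV hx hxv
  obtain ⟨h', y', hh', -, hxy', hhy'⟩ := exists_weight_operators hx e he
  have hhv : ∀ i : ℕ, h ((x ^ i) v) = (2 * (i : K) - d) • (x ^ i) v := by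
    intro i
    rw [hpow, hv, map_smul, ← add_smul]
    congr 1; ring
  -- In the model built on `v`, the semisimple element is `h` itself, so projecting `y'` to `g`
  -- preserves both remaining relations.
  obtain rfl : h' = h := e.ext fun i => by rw [he, hhv, hh']
  refine ⟨v, e, h', p y', he, hhg, (p y').2, hhv, hhx, ?_, ?_⟩
  · rw [← hplie hxg, hxy', projection_of_mem hp hhg]
  · rw [← hplie hhg, hhy']
    simp

end LieSubalgebra

/-! ### The decomposition of `g` under the triple and the powers of `x` in `g` -/

/-- Triangularity with respect to a nilpotent operator implies linear independence. -/
theorem linearIndependent_of_pow_apply {K M ι : Type*} [Field K] [AddCommGroup M] [Module K M]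
    [Fintype ι] (φ : Module.End K M) (w t : ι → M) (l : ι → ℕ)
    (h0 : ∀ i m, l i < m → (φ ^ m) (w i) = 0) (h1 : ∀ i, (φ ^ l i) (w i) = t i)
    (hind : ∀ N, LinearIndependent K fun i : {i // l i = N} => t i) : LinearIndependent K w := by
  classical
  rw [Fintype.linearIndependent_iff]
  intro c hc
  by_contra! hne
  obtain ⟨i0, hi0⟩ := hne
  let S : Finset ι := Finset.univ.filter fun i => c i ≠ 0
  -- In a relation, choose a term with nonzero coefficient and maximal level `l m`. Applying `φ ^ l
  -- m` kills the lower levels and leaves a relation among the `t i` of that level.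
  obtain ⟨m, hm, hmax⟩ := S.exists_max_image l ⟨i0, by simp [S, hi0]⟩
  have hm' : c m ≠ 0 := by simpa [S] using hm
  have h2 := congrArg (φ ^ l m) hc
  rw [map_sum, map_zero] at h2
  have h3 : ∀ i, (φ ^ l m) (c i • w i) = if l i = l m then c i • t i else 0 := by
    intro i
    rw [map_smul]
    by_cases hci : c i = 0
    · simp [hci]
    rcases lt_trichotomy (l i) (l m) with h | h | h
    · rw [h0 i _ h, if_neg h.ne, smul_zero]
    · rw [← h, h1 i, if_pos rfl]
    · exact absurd (hmax i (by simp [S, hci])) (not_le.2 h)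
  simp only [h3] at h2
  rw [← Finset.sum_filter, ← Finset.sum_subtype_of_mem (p := fun i => l i = l m)
    (f := fun i => c i • t i)] at h2
  · have h4 := linearIndependent_iff'.1 (hind (l m))
      (Finset.subtype (fun i => l i = l m) (Finset.univ.filter fun i => l i = l m))
      (fun i => c i) h2 ⟨m, rfl⟩ (by simp)
    exact hm' h4
  · simp

section CyclicSl2

open Module LieModule

/-- An `sl₂`-triple in a linear Lie algebra `g` for which the natural module is irreducible of
dimension `d + 1`, with lowest weight vector `v`. -/
structure IsCyclicSl2 {K V : Type*} [Field K] [AddCommGroup V] [Module K V]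
    (g : LieSubalgebra K (Module.End K V)) {d : ℕ} (e : Basis (Fin (d + 1)) K V) (v : V)
    (x h y : Module.End K V) : Prop where
  basis_apply : ∀ i, e i = (x ^ (i : ℕ)) v
  pow_eq_zero : x ^ (d + 1) = 0
  x_mem : x ∈ g
  h_mem : h ∈ g
  y_mem : y ∈ g
  h_pow : ∀ i : ℕ, h ((x ^ i) v) = (2 * (i : K) - d) • (x ^ i) v
  lie_h_x : ⁅h, x⁆ = (2 : K) • x
  lie_x_y : ⁅x, y⁆ = h
  lie_h_y : ⁅h, y⁆ = (-2 : K) • y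

open Classical in
/-- The exponents `r` of the powers of `x` which belong to `g`. -/
noncomputable def powExponents {K V : Type*} [Field K] [AddCommGroup V] [Module K V]
    (g : LieSubalgebra K (Module.End K V)) (x : Module.End K V) (d : ℕ) : Finset ℕ :=
  (Finset.Icc 1 d).filter fun r => x ^ r ∈ g

theorem mem_powExponents {K V : Type*} [Field K] [AddCommGroup V] [Module K V]
    {g : LieSubalgebra K (Module.End K V)} {x : Module.End K V} {d r : ℕ} :
    r ∈ powExponents g x d ↔ 1 ≤ r ∧ r ≤ d ∧ x ^ r ∈ g := by
  simp [powExponents, and_assoc]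

theorem lie_self_pow {K V : Type*} [Field K] [AddCommGroup V] [Module K V]
    (x : Module.End K V) (i : ℕ) : ⁅x, x ^ i⁆ = 0 := by
  rw [Ring.lie_def, sub_eq_zero]
  exact ((Commute.refl x).pow_right i).eq

namespace IsCyclicSl2

variable {K V : Type*} [Field K] [CharZero K] [AddCommGroup V] [Module K V]
  {g : LieSubalgebra K (Module.End K V)} {d : ℕ}
  {e : Basis (Fin (d + 1)) K V} {v : V} {x h y : Module.End K V}
  (T : IsCyclicSl2 g e v x h y)

include T

omit [CharZero K] in
theorem linearIndependent_pow :
    LinearIndependent K fun i : Fin (d + 1) => x ^ (i : ℕ) := by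
  have h1 : LinearIndependent K (⇑(LinearMap.applyₗ v : Module.End K V →ₗ[K] V) ∘
      fun i : Fin (d + 1) => x ^ (i : ℕ)) := by
    convert e.linearIndependent using 1
    ext i
    exact (T.basis_apply i).symm
  exact LinearIndependent.of_comp _ h1

omit [CharZero K] in
theorem linearIndependent_smul_pow {ι : Type*} (f : ι → ℕ) (hf : Function.Injective f)
    (hfd : ∀ i, f i ≤ d) (c : ι → K) (hc : ∀ i, c i ≠ 0) :
    LinearIndependent K fun i => c i • x ^ f i := by
  have h1 := T.linearIndependent_pow.comp (fun i => (⟨f i, Nat.lt_succ_of_le (hfd i)⟩ : Fin (d + 1)))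
    (fun i j hij => hf (congrArg Fin.val hij))
  exact h1.units_smul fun i => Units.mk0 (c i) (hc i)

omit [CharZero K] in
theorem pow_ne_zero {i : ℕ} (hi : i ≤ d) : x ^ i ≠ 0 :=
  T.linearIndependent_pow.ne_zero ⟨i, Nat.lt_succ_of_le hi⟩

theorem isSl2Triple (hd : d ≠ 0) : IsSl2Triple h x y where
  h_ne_zero := by
    rintro rfl
    have h1 := T.h_pow 0
    have h2 := T.basis_apply 0
    simp only [Fin.val_zero, pow_zero, Module.End.one_apply] at h2
    simp only [pow_zero, Module.End.one_apply, LinearMap.zero_apply, Nat.cast_zero, mul_zero,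
      zero_sub, ← h2] at h1
    rcases smul_eq_zero.1 h1.symm with h3 | h3
    · exact hd (by simpa using h3)
    · exact e.ne_zero 0 h3
  lie_e_f := T.lie_x_y
  lie_h_e_nsmul := by rw [T.lie_h_x, ← Nat.cast_smul_eq_nsmul K]; simp
  lie_h_f_nsmul := by rw [T.lie_h_y, ← Nat.cast_smul_eq_nsmul K]; simp

theorem hasPrimitiveVectorWith (hd : d ≠ 0) {r : ℕ} (hr : r ≤ d) :
    (T.isSl2Triple hd).HasPrimitiveVectorWith (x ^ r) (2 * r : K) where
  ne_zero := T.pow_ne_zero hr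
  lie_h := lie_pow_of_lie T.lie_h_x r
  lie_e := lie_self_pow x r

omit [CharZero K] in
-- Whatever commutes with `x` is a polynomial in `x`, and the powers `x ^ i` have distinct weights
-- `2 i` under `ad h`.
theorem eq_smul_pow {q : Module.End K V} {m : ℕ} [CharZero K] (hq : ⁅x, q⁆ = 0)
    (hqh : ⁅h, q⁆ = (2 * m : K) • q) : ∃ c : K, q = c • x ^ m := by
  have hcomm : Commute q x := by
    rw [Ring.lie_def, sub_eq_zero] at hq
    exact hq.symm
  obtain ⟨c, hc⟩ := eq_sum_pow_of_commute e T.basis_apply hcomm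
  have h1 : ∑ i : Fin (d + 1), (c i * (2 * (i : ℕ) - 2 * m)) • x ^ (i : ℕ) = 0 := by
    have : ∑ i : Fin (d + 1), (c i * (2 * ((i : ℕ) : K))) • x ^ (i : ℕ) =
        ∑ i : Fin (d + 1), (c i * (2 * (m : K))) • x ^ (i : ℕ) := by
      calc _ = ⁅h, q⁆ := by
            rw [hc, lie_sum]
            refine Finset.sum_congr rfl fun i _ => ?_
            rw [lie_smul, lie_pow_of_lie T.lie_h_x, smul_smul]
        _ = _ := by
            rw [hqh, hc, Finset.smul_sum]
            refine Finset.sum_congr rfl fun i _ => ?_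
            rw [smul_smul, mul_comm]
    simp only [mul_sub, sub_smul, Finset.sum_sub_distrib, this, sub_self]
  have h2 := Fintype.linearIndependent_iff.1 T.linearIndependent_pow _ h1
  have h3 : ∀ i : Fin (d + 1), (i : ℕ) ≠ m → c i = 0 := by
    intro i hi
    refine (mul_eq_zero.1 (h2 i)).resolve_right ?_
    rw [← mul_sub]
    refine mul_ne_zero two_ne_zero (sub_ne_zero.2 ?_)
    exact_mod_cast hi
  by_cases hm : m < d + 1
  · refine ⟨c ⟨m, hm⟩, ?_⟩
    rw [hc, Finset.sum_eq_single ⟨m, hm⟩]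
    · intro i _ hi
      rw [h3 i fun h => hi (Fin.ext h), zero_smul]
    · simp
  · refine ⟨0, ?_⟩
    rw [hc, zero_smul]
    refine Finset.sum_eq_zero fun i _ => ?_
    rw [h3 i (by omega), zero_smul]

omit [CharZero K] in
theorem toEnd_y_pow_mem {z : Module.End K V} (hz : z ∈ g) (j : ℕ) :
    ((toEnd K (Module.End K V) (Module.End K V) y) ^ j) z ∈ g := by
  induction j with
  | zero => simpa
  | succ j ih =>
    rw [pow_succ', Module.End.mul_apply]
    exact g.lie_mem T.y_mem ih

omit [CharZero K] in
theorem toEnd_x_pow_mem {z : Module.End K V} (hz : z ∈ g) (j : ℕ) :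
    ((toEnd K (Module.End K V) (Module.End K V) x) ^ j) z ∈ g := by
  induction j with
  | zero => simpa
  | succ j ih =>
    rw [pow_succ', Module.End.mul_apply]
    exact g.lie_mem T.x_mem ih

/-- The scalar is the product of the factors `(i + 1) (2 r - i)` for `i < j`, which vanishes only
beyond the end of the string of length `2 r + 1`. -/
theorem exists_toEnd_pow_pow (hd : d ≠ 0) {r : ℕ} (hr : r ≤ d) (j : ℕ) :
    ∃ c : K, (j ≤ 2 * r → c ≠ 0) ∧
      ((toEnd K (Module.End K V) (Module.End K V) x) ^ j)
        (((toEnd K (Module.End K V) (Module.End K V) y) ^ j) (x ^ r)) = c • x ^ r := by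
  induction j with
  | zero => exact ⟨1, by simp, by simp⟩
  | succ j ih =>
    obtain ⟨c, hc0, hc⟩ := ih
    refine ⟨((j + 1) * (2 * r - j)) * c, fun hj => ?_, ?_⟩
    · refine mul_ne_zero (mul_ne_zero (Nat.cast_add_one_ne_zero j) ?_) (hc0 (by omega))
      rw [sub_ne_zero]
      have : 2 * r ≠ j := by omega
      exact_mod_cast this
    · have h1 := (T.hasPrimitiveVectorWith hd hr).lie_e_pow_succ_toEnd_f j
      rw [pow_succ (toEnd K (Module.End K V) (Module.End K V) x), Module.End.mul_apply,
        toEnd_apply_apply, h1, map_smul, hc, smul_smul]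

theorem toEnd_pow_pow_eq_zero (hd : d ≠ 0) {r : ℕ} (hr : r ≤ d) {j m : ℕ} (hm : j < m) :
    ((toEnd K (Module.End K V) (Module.End K V) x) ^ m)
      (((toEnd K (Module.End K V) (Module.End K V) y) ^ j) (x ^ r)) = 0 := by
  obtain ⟨n, rfl⟩ : ∃ n, m = n + 1 + j := ⟨m - j - 1, by omega⟩
  obtain ⟨c, -, hc⟩ := T.exists_toEnd_pow_pow hd hr j
  rw [pow_add, Module.End.mul_apply, hc, map_smul, pow_succ, Module.End.mul_apply,
    toEnd_apply_apply, lie_self_pow x, map_zero, smul_zero]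

/-- Each `x ^ r ∈ g` generates under `ad y` a string of `2 r + 1` vectors of `g`. Applying `(ad x) ^
j` to the `j`-th vector returns to a nonzero multiple of `x ^ r`, so all these vectors together are
independent. -/
theorem sum_powExponents_le_finrank [FiniteDimensional K V] (hd : d ≠ 0) :
    ∑ r ∈ powExponents g x d, (2 * r + 1) ≤ finrank K g := by
  let ι := Σ r : powExponents g x d, Fin (2 * (r : ℕ) + 1)
  let w : ι → g := fun i => ⟨((toEnd K (Module.End K V) (Module.End K V) y) ^ (i.2 : ℕ))
    (x ^ (i.1 : ℕ)), T.toEnd_y_pow_mem (mem_powExponents.1 i.1.2).2.2 _⟩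
  have hle : ∀ i : ι, (i.1 : ℕ) ≤ d := fun i => (mem_powExponents.1 i.1.2).2.1
  choose c hc0 hc using fun i : ι => T.exists_toEnd_pow_pow hd (hle i) (i.2 : ℕ)
  have hli : LinearIndependent K (⇑g.toSubmodule.subtype ∘ w) := by
    refine linearIndependent_of_pow_apply (toEnd K (Module.End K V) (Module.End K V) x) _
      (fun i : ι => c i • x ^ (i.1 : ℕ)) (fun i => (i.2 : ℕ))
      (fun i m hm => T.toEnd_pow_pow_eq_zero hd (hle i) hm) hc ?_
    intro N
    refine T.linearIndependent_smul_pow (fun i : {i : ι // (i.2 : ℕ) = N} => (i.1.1 : ℕ)) ?_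
      (fun i => hle i.1) (fun i => c i.1) (fun i => hc0 i.1 (by omega))
    rintro ⟨⟨⟨r, hr⟩, j⟩, hi⟩ ⟨⟨⟨s, hs⟩, k⟩, hk⟩ hij
    simp only at hij hi hk
    subst hij
    have : j = k := Fin.ext (hi.trans hk.symm)
    subst this
    rfl
  have h1 := (LinearIndependent.of_comp _ hli).fintype_card_le_finrank
  have h2 : Fintype.card ι = ∑ r ∈ powExponents g x d, (2 * r + 1) := by
    rw [Fintype.card_sigma]
    simp only [Fintype.card_fin]
    exact Finset.sum_coe_sort (powExponents g x d) fun r => 2 * r + 1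
  rwa [h2] at h1

/-- If `(ad x) ^ (m + 1)` kills a vector `z` of weight zero, then `(ad x) ^ m z` commutes with `x`
and has weight `2 m`, hence is a multiple of `x ^ m`. If it is nonzero then `x ^ m ∈ g`, and
subtracting a multiple of `(ad y) ^ m (x ^ m)` lowers `m`. -/
theorem mem_span_of_toEnd_pow_eq_zero (hd : d ≠ 0)
    (hsl : ∀ a ∈ g, LinearMap.trace K V a = 0) (m : ℕ) :
    ∀ z ∈ g, ⁅h, z⁆ = 0 → ((toEnd K (Module.End K V) (Module.End K V) x) ^ m) z = 0 →
      z ∈ Submodule.span K (Set.range fun r : powExponents g x d =>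
        ((toEnd K (Module.End K V) (Module.End K V) y) ^ (r : ℕ)) (x ^ (r : ℕ))) := by
  induction m with
  | zero =>
    intro z _ _ hz
    have : z = 0 := by simpa using hz
    rw [this]
    exact Submodule.zero_mem _
  | succ m ih =>
    intro z hzg hzh hz
    set q := ((toEnd K (Module.End K V) (Module.End K V) x) ^ m) z with hq
    have hq1 : ⁅x, q⁆ = 0 := by
      rw [pow_succ', Module.End.mul_apply] at hz
      exact hz
    have hq2 : ⁅h, q⁆ = (2 * m : K) • q := by
      have := (T.isSl2Triple hd).lie_h_pow_toEnd_e (R := K) (m := z) (μ := 0)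
        (by rw [hzh, zero_smul]) m
      rwa [zero_add] at this
    have hqg : q ∈ g := T.toEnd_x_pow_mem hzg m
    obtain ⟨c, hc⟩ := T.eq_smul_pow hq1 hq2
    by_cases hq0 : q = 0
    · exact ih z hzg hzh hq0
    have hc0 : c ≠ 0 := by
      rintro rfl
      exact hq0 (by rw [hc, zero_smul])
    have hxm : x ^ m ∈ g := by
      have := g.smul_mem c⁻¹ hqg
      rwa [hc, smul_smul, inv_mul_cancel₀ hc0, one_smul] at this
    have hmd : m ≤ d := by
      by_contra hmd
      apply hq0
      rw [hc, pow_eq_zero_of_le (by omega) T.pow_eq_zero, smul_zero]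
    -- The power `x ^ 0 = 1` is not in `g`, since its trace is `d + 1 ≠ 0`.
    have hm1 : 1 ≤ m := by
      by_contra hm1
      obtain rfl : m = 0 := by omega
      have h1 := hsl _ hxm
      have : FiniteDimensional K V := Module.Finite.of_basis e
      rw [pow_zero, LinearMap.trace_one, Nat.cast_eq_zero, finrank_eq_card_basis e] at h1
      simp at h1
    obtain ⟨b, hb0, hb⟩ := T.exists_toEnd_pow_pow hd hmd m
    have hb0 := hb0 (by omega)
    set w := ((toEnd K (Module.End K V) (Module.End K V) y) ^ m) (x ^ m) with hw
    have hwh : ⁅h, w⁆ = 0 := by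
      have := (T.hasPrimitiveVectorWith hd hmd).lie_h_pow_toEnd_f m
      rwa [sub_self, zero_smul] at this
    have hwmem : w ∈ Submodule.span K (Set.range fun r : powExponents g x d =>
        ((toEnd K (Module.End K V) (Module.End K V) y) ^ (r : ℕ)) (x ^ (r : ℕ))) :=
      Submodule.subset_span ⟨⟨m, mem_powExponents.2 ⟨hm1, hmd, hxm⟩⟩, rfl⟩
    have h2 := ih (z - (c / b) • w)
      (g.sub_mem hzg (g.smul_mem _ (T.toEnd_y_pow_mem hxm m)))
      (by rw [lie_sub, lie_smul, hzh, hwh, smul_zero, sub_zero])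
      (by rw [map_sub, map_smul, hb, ← hq, hc, smul_smul, div_mul_cancel₀ _ hb0, sub_self])
    have h3 := Submodule.add_mem _ h2 (Submodule.smul_mem _ (c / b) hwmem)
    rwa [sub_add_cancel] at h3

theorem finrank_ker_ad_le [FiniteDimensional K V] (hd : d ≠ 0)
    (hsl : ∀ a ∈ g, LinearMap.trace K V a = 0) :
    finrank K (LinearMap.ker (LieAlgebra.ad K g ⟨h, T.h_mem⟩)) ≤ (powExponents g x d).card := by
  set C := LinearMap.ker (LieAlgebra.ad K g ⟨h, T.h_mem⟩)
  have h1 : C.map g.toSubmodule.subtype ≤ Submodule.span K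
      (Set.range fun r : powExponents g x d =>
        ((toEnd K (Module.End K V) (Module.End K V) y) ^ (r : ℕ)) (x ^ (r : ℕ))) := by
    rintro _ ⟨z, hz, rfl⟩
    obtain ⟨N, hN⟩ := LieAlgebra.ad_nilpotent_of_nilpotent (R := K) (a := x)
      ⟨d + 1, T.pow_eq_zero⟩
    refine T.mem_span_of_toEnd_pow_eq_zero hd hsl N _ z.2 ?_ ?_
    · exact congrArg Subtype.val (LinearMap.mem_ker.1 hz)
    · exact LinearMap.congr_fun hN (z : Module.End K V)
  have h2 := Submodule.finrank_mono h1
  rw [← (Submodule.equivMapOfInjective _ g.toSubmodule.injective_subtype C).finrank_eq] at h2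
  refine h2.trans ((finrank_range_le_card _).trans ?_)
  simp

omit [CharZero K] in
theorem lie_pow_succ_y (r : ℕ) : ∃ c : K,
    ⁅x ^ (r + 1), y⁆ = (r + 1 : K) • (h * x ^ r) + c • x ^ r := by
  induction r with
  | zero => exact ⟨0, by simp [T.lie_x_y]⟩
  | succ r ih =>
    obtain ⟨c, hc⟩ := ih
    have h1 := lie_pow_of_lie T.lie_h_x (r + 1)
    have h2 := T.lie_x_y
    refine ⟨c - 2 * (r + 1), ?_⟩
    rw [Ring.lie_def] at *
    have : x ^ (r + 1 + 1) * y - y * x ^ (r + 1 + 1) =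
        x ^ (r + 1) * (x * y - y * x) + (x ^ (r + 1) * y - y * x ^ (r + 1)) * x := by
      rw [pow_succ x (r + 1)]; noncomm_ring
    rw [this, hc, h2, ← sub_eq_zero]
    have h3 : x ^ (r + 1) * h = h * x ^ (r + 1) - (2 * ((r + 1 : ℕ) : K)) • x ^ (r + 1) := by
      rw [← h1]; abel
    rw [h3, add_mul, smul_mul_assoc, smul_mul_assoc, mul_assoc, ← pow_succ]
    push_cast
    module

/-- This is the content of part (ii). In `⁅x ^ r, y⁆ = r h x ^ (r - 1) + c x ^ (r - 1)` only the
factor `h` fails to commute with `x ^ s`, so bracketing with `x ^ s` gives `2 r s x ^ (r + s - 1)`.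
-/
theorem add_sub_one_mem_powExponents {r s : ℕ} (hr : r ∈ powExponents g x d)
    (hs : s ∈ powExponents g x d) (hrs : r + s ≤ d + 1) : r + s - 1 ∈ powExponents g x d := by
  rw [mem_powExponents] at *
  obtain ⟨r, rfl⟩ : ∃ k, r = k + 1 := ⟨r - 1, by omega⟩
  refine ⟨by omega, by omega, ?_⟩
  have h1 : ⁅⁅x ^ (r + 1), y⁆, x ^ s⁆ ∈ g := g.lie_mem (g.lie_mem hr.2.2 T.y_mem) hs.2.2
  obtain ⟨c, hc⟩ := T.lie_pow_succ_y r
  have h2 := lie_pow_of_lie T.lie_h_x s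
  have h3 : ⁅⁅x ^ (r + 1), y⁆, x ^ s⁆ = ((r + 1 : K) * (2 * s)) • x ^ (r + 1 + s - 1) := by
    have h4 : ⁅h * x ^ r, x ^ s⁆ = (2 * (s : K)) • x ^ (r + s) := by
      rw [Ring.lie_def] at *
      have : h * x ^ r * x ^ s - x ^ s * (h * x ^ r) = (h * x ^ s - x ^ s * h) * x ^ r := by
        rw [sub_mul, mul_assoc, mul_assoc, mul_assoc, ← pow_add, ← pow_add, add_comm]
      rw [this, h2, smul_mul_assoc, ← pow_add, add_comm s]
    have h5 : ⁅x ^ r, x ^ s⁆ = 0 := by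
      rw [Ring.lie_def, ← pow_add, ← pow_add, add_comm, sub_self]
    rw [hc, add_lie, smul_lie, smul_lie, h4, h5, smul_zero, add_zero, smul_smul]
    congr 2
    omega
  have h6 : ((r + 1 : K) * (2 * s)) ≠ 0 := by
    refine mul_ne_zero (Nat.cast_add_one_ne_zero r) (mul_ne_zero two_ne_zero ?_)
    exact Nat.cast_ne_zero.2 (by omega)
  have h7 := g.smul_mem ((r + 1 : K) * (2 * s))⁻¹ (h3 ▸ h1)
  rwa [smul_smul, inv_mul_cancel₀ h6, one_smul] at h7

omit [CharZero K] in
theorem lie_x_h_pow_mul (r l : ℕ) : ⁅x, h ^ r * x ^ l⁆ =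
    ∑ i ∈ Finset.range r, ((-2 : K) ^ (r - i) * (r.choose i : K)) • (h ^ i * x ^ (l + 1)) := by
  have h1 : x * h = (h - algebraMap K _ 2) * x := by
    have := T.lie_h_x
    rw [Ring.lie_def, sub_eq_iff_eq_add] at this
    rw [sub_mul, this, Algebra.algebraMap_eq_smul_one, smul_mul_assoc, one_mul]
    abel
  have h2 : x * h ^ r = (h - algebraMap K _ 2) ^ r * x :=
    ((show SemiconjBy x h (h - algebraMap K _ 2) from h1).pow_right r).eq
  have h3 : (h - algebraMap K _ 2) ^ r = ∑ i ∈ Finset.range (r + 1),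
      ((-2 : K) ^ (r - i) * (r.choose i : K)) • h ^ i := by
    rw [sub_eq_add_neg, ← map_neg, (Algebra.commute_algebraMap_right (-2 : K) h).add_pow]
    refine Finset.sum_congr rfl fun i _ => ?_
    rw [← map_pow, mul_assoc, ← map_natCast (algebraMap K (Module.End K V)), ← map_mul,
      ← Algebra.commutes, Algebra.smul_def]
  rw [Ring.lie_def, ← mul_assoc, h2, h3, mul_assoc, mul_assoc, ← pow_succ', ← pow_succ,
    Finset.sum_range_succ, add_mul, Finset.sum_mul]
  simp

omit [CharZero K] in
-- As `x h = (h - 2) x`, applying `ad x` lowers the degree in `h` by one and contributes a factor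
-- `x` on the right. Only the leading term survives `r` applications; the extra exponent `l` absorbs
-- the accumulated factors `x`.
theorem toEnd_x_pow_h_pow_mul (r : ℕ) : ∀ l : ℕ,
    (∀ m, r < m →
      ((toEnd K (Module.End K V) (Module.End K V) x) ^ m) (h ^ r * x ^ l) = 0) ∧
    ((toEnd K (Module.End K V) (Module.End K V) x) ^ r) (h ^ r * x ^ l) =
      ((-2 : K) ^ r * (r.factorial : K)) • x ^ (l + r) := by
  induction r using Nat.strong_induction_on with
  | _ r ih =>
    intro l
    constructor
    · intro m hm
      obtain ⟨m, rfl⟩ : ∃ n, m = n + 1 := ⟨m - 1, by omega⟩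
      rw [pow_succ, Module.End.mul_apply, toEnd_apply_apply, T.lie_x_h_pow_mul, map_sum]
      refine Finset.sum_eq_zero fun i hi => ?_
      have hi' := Finset.mem_range.1 hi
      rw [map_smul, (ih i hi' (l + 1)).1 m (by omega), smul_zero]
    · cases r with
      | zero => simp
      | succ r =>
        rw [pow_succ (toEnd K (Module.End K V) (Module.End K V) x), Module.End.mul_apply,
          toEnd_apply_apply, T.lie_x_h_pow_mul, map_sum, Finset.sum_range_succ,
          Finset.sum_eq_zero, zero_add, map_smul, (ih r (by omega) (l + 1)).2, smul_smul]
        · rw [Nat.factorial_succ, Nat.choose_succ_self_right, Nat.add_sub_cancel_left]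
          congr 1
          · push_cast; ring
          · congr 1; omega
        · intro i hi
          have hi' := Finset.mem_range.1 hi
          rw [map_smul, (ih i (by omega) (l + 1)).1 r hi', smul_zero]

/-- Since `p` commutes with `ad x`, one has `(ad x) ^ r (p (h ^ r)) = (-2) ^ r r! p (x ^ r)`, and `p
(x ^ r) = x ^ r` because `x ^ r ∈ g`. Thus the family is triangular over the independent powers of
`x`. -/
theorem linearIndependent_projection_h_pow [FiniteDimensional K V]
    [LieAlgebra.IsSemisimple K g] {p : Module.End K V →ₗ[K] g}
    (hp : ∀ a (w : g),
      LinearMap.trace K V ((p a : Module.End K V) * w) = LinearMap.trace K V (a * w)) :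
    LinearIndependent K fun r : powExponents g x d => p (h ^ (r : ℕ)) := by
  have hcomm : ∀ (m : ℕ) (a : Module.End K V),
      ((toEnd K (Module.End K V) (Module.End K V) x) ^ m) (p a : Module.End K V) =
        p (((toEnd K (Module.End K V) (Module.End K V) x) ^ m) a) := by
    intro m
    induction m with
    | zero => intro a; simp
    | succ m ih =>
      intro a
      have := LieSubalgebra.projection_lie hp ⟨x, T.x_mem⟩ a
      rw [pow_succ, Module.End.mul_apply, Module.End.mul_apply, toEnd_apply_apply,
        toEnd_apply_apply, ← ih, this, LieSubalgebra.coe_bracket]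
  have hli : LinearIndependent K (⇑g.toSubmodule.subtype ∘
      fun r : powExponents g x d => p (h ^ (r : ℕ))) := by
    refine linearIndependent_of_pow_apply (toEnd K (Module.End K V) (Module.End K V) x) _
      (fun r : powExponents g x d =>
        ((-2 : K) ^ (r : ℕ) * ((r : ℕ).factorial : K)) • x ^ (r : ℕ)) (fun r => (r : ℕ)) ?_ ?_ ?_
    · intro r m hm
      have := (T.toEnd_x_pow_h_pow_mul r 0).1 m hm
      rw [pow_zero, mul_one] at this
      simp only [Function.comp_apply, Submodule.subtype_apply]
      rw [hcomm, this]
      simp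
    · intro r
      have := (T.toEnd_x_pow_h_pow_mul r 0).2
      rw [pow_zero, mul_one, zero_add] at this
      simp only [Function.comp_apply, Submodule.subtype_apply]
      rw [hcomm, this]
      exact LieSubalgebra.projection_of_mem hp
        (g.smul_mem _ (mem_powExponents.1 r.2).2.2)
    · intro N
      refine T.linearIndependent_smul_pow
        (fun i : {i : powExponents g x d // (i : ℕ) = N} => (i.1 : ℕ)) ?_
        (fun i => (mem_powExponents.1 i.1.2).2.1) _ fun i => ?_
      · rintro ⟨⟨i, _⟩, _⟩ ⟨⟨j, _⟩, _⟩ hij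
        simp only at hij
        subst hij
        rfl
      · exact mul_ne_zero (_root_.pow_ne_zero _ (by simp)) (Nat.cast_ne_zero.2 (Nat.factorial_ne_zero _))
  exact LinearIndependent.of_comp _ hli

end IsCyclicSl2

end CyclicSl2

/-! ### Derivations, conjugation and traces over a commutative coefficient ring -/

namespace TrivSqZeroExt

/-- The ring homomorphism `r ↦ r + ε D r` attached to a derivation `D`. -/
def ofDerivation {K R : Type*} [CommRing K] [CommRing R] [Algebra K R] (D : Derivation K R R) :
    R →+* TrivSqZeroExt R R where
  toFun r := inl r + inr (D r)
  map_one' := by simp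
  map_zero' := by simp
  map_add' r s := by
    ext <;> simp
  map_mul' r s := by
    ext <;> simp [mul_comm]

end TrivSqZeroExt

open TrivSqZeroExt in
/-- The coefficients of the characteristic polynomial are constants of a derivation that acts on
a matrix as a commutator. -/
theorem Matrix.derivation_charpoly_coeff {K R m : Type*} [CommRing K] [CommRing R] [Algebra K R]
    [Fintype m] [DecidableEq m] (D : Derivation K R R) (M U : Matrix m m R)
    (h : M.map D = U * M - M * U) (i : ℕ) : D (M.charpoly.coeff i) = 0 := by
  let N : Matrix m m (TrivSqZeroExt R R) := M.map (inlHom R R)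
  let E : Matrix m m (TrivSqZeroExt R R) := U.map inr
  have hEE : ∀ A B : Matrix m m R,
      A.map (inr : R → TrivSqZeroExt R R) * B.map (inr : R → TrivSqZeroExt R R) = 0 := by
    intro A B
    ext i j <;> simp [Matrix.mul_apply]
  have hEN : E * N = (U * M).map inr := by
    ext i j
    · simp [E, N, Matrix.mul_apply, fst_sum, -DualNumber.inr_eq_smul_eps]
    · simp [E, N, Matrix.mul_apply, snd_sum, mul_comm, -DualNumber.inr_eq_smul_eps]
  have hNE : N * E = (M * U).map inr := by
    ext i j
    · simp [E, N, Matrix.mul_apply, fst_sum, -DualNumber.inr_eq_smul_eps]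
    · simp [E, N, Matrix.mul_apply, snd_sum, -DualNumber.inr_eq_smul_eps]
  let u : (Matrix m m (TrivSqZeroExt R R))ˣ :=
    { val := 1 + E
      inv := 1 - E
      val_inv := by
        have := hEE U U
        change E * E = 0 at this
        rw [add_mul, mul_sub, mul_sub, this]; simp
      inv_val := by
        have := hEE U U
        change E * E = 0 at this
        rw [sub_mul, mul_add, mul_add, this]; simp }
  have hu : (u : Matrix m m (TrivSqZeroExt R R)) = 1 + E := rfl
  have hu' : ((u⁻¹ : (Matrix m m (TrivSqZeroExt R R))ˣ) : Matrix m m (TrivSqZeroExt R R)) =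
    1 - E := rfl
  -- With `ε ^ 2 = 0`, the hypothesis says `M + ε D M = (1 + ε U) M (1 - ε U)`. Conjugate matrices
  -- have equal characteristic polynomials, and the `ε`-parts of the coefficients are their
  -- derivatives.
  have hM : M.map (ofDerivation D) = u.val * N * (u⁻¹).val := by
    have h1 : u.val * N * (u⁻¹).val = N + (E * N - N * E) - E * N * E := by
      rw [hu, hu']; noncomm_ring
    rw [h1, hEN, hNE, hEE, sub_zero]
    ext i j
    · simp [N, ofDerivation]
    · have := congrFun (congrFun h i) j
      simp only [Matrix.map_apply, Matrix.sub_apply] at this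
      simp [N, ofDerivation, this]
  have h2 : M.charpoly.map (ofDerivation D) = M.charpoly.map (inlHom R R) := by
    rw [← Matrix.charpoly_map, ← Matrix.charpoly_map, hM, Matrix.coe_units_inv]
    exact Matrix.charpoly_units_conj u N
  have h3 := congrArg (fun p => snd (Polynomial.coeff p i)) h2
  simpa [ofDerivation] using h3

section TensorEnd

open TensorProduct

variable {K R A : Type*} [Field K] [CommRing R] [Algebra K R] [Ring A] [Algebra K A]

/-- The action of a derivation of `R` on `R ⊗ A` by `D ⊗ 1`. -/
noncomputable def Derivation.tensor (A : Type*) [Ring A] [Algebra K A] (D : Derivation K R R) :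
    R ⊗[K] A →ₗ[K] R ⊗[K] A :=
  LinearMap.rTensor A (D : R →ₗ[K] R)

@[simp]
theorem Derivation.tensor_tmul (D : Derivation K R R) (r : R) (a : A) :
    D.tensor A (r ⊗ₜ a) = D r ⊗ₜ a := rfl

theorem Derivation.tensor_mul (D : Derivation K R R) (Y Z : R ⊗[K] A) :
    D.tensor A (Y * Z) = D.tensor A Y * Z + Y * D.tensor A Z := by
  induction Y using TensorProduct.induction_on with
  | zero => simp
  | add Y Y' hY hY' => rw [add_mul, map_add, hY, hY', map_add, add_mul, add_mul]; abel
  | tmul r a =>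
    induction Z using TensorProduct.induction_on with
    | zero => simp
    | add Z Z' hZ hZ' => rw [mul_add, map_add, hZ, hZ', map_add, mul_add, mul_add]; abel
    | tmul s b =>
      simp only [Algebra.TensorProduct.tmul_mul_tmul, Derivation.tensor_tmul, Derivation.leibniz,
        smul_eq_mul, ← TensorProduct.add_tmul]
      rw [add_comm, mul_comm s]

theorem Derivation.tensor_pow_of_commutator (D : Derivation K R R) {U Z : R ⊗[K] A}
    (hZ : D.tensor A Z = U * Z - Z * U) (m : ℕ) :
    D.tensor A (Z ^ m) = U * Z ^ m - Z ^ m * U := by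
  induction m with
  | zero =>
    rw [pow_zero, Algebra.TensorProduct.one_def, Derivation.tensor_tmul, D.map_one_eq_zero,
      TensorProduct.zero_tmul, ← Algebra.TensorProduct.one_def, one_mul, mul_one, sub_self]
  | succ m ih =>
    rw [pow_succ, D.tensor_mul, ih, hZ]
    noncomm_ring

/-- The `R`-valued extension to `R ⊗ A` of a linear functional on `A`. -/
noncomputable def tensorTrace (R : Type*) [CommRing R] [Algebra K R] (τ : A →ₗ[K] K) :
    R ⊗[K] A →ₗ[K] R :=
  (TensorProduct.rid K R).toLinearMap ∘ₗ LinearMap.lTensor R τ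

@[simp]
theorem tensorTrace_tmul (τ : A →ₗ[K] K) (r : R) (a : A) :
    tensorTrace R τ (r ⊗ₜ a) = τ a • r := by
  simp [tensorTrace]

theorem tensorTrace_mul_comm (τ : A →ₗ[K] K) (hτ : ∀ a b, τ (a * b) = τ (b * a))
    (Y Z : R ⊗[K] A) : tensorTrace R τ (Y * Z) = tensorTrace R τ (Z * Y) := by
  induction Y using TensorProduct.induction_on with
  | zero => simp
  | add Y Y' hY hY' => rw [add_mul, mul_add, map_add, map_add, hY, hY']
  | tmul r a =>
    induction Z using TensorProduct.induction_on with
    | zero => simp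
    | add Z Z' hZ hZ' => rw [add_mul, mul_add, map_add, map_add, hZ, hZ']
    | tmul s b =>
      simp [Algebra.TensorProduct.tmul_mul_tmul, hτ a b, mul_comm r s]

theorem Derivation.tensorTrace (D : Derivation K R R) (τ : A →ₗ[K] K) (Y : R ⊗[K] A) :
    D (tensorTrace R τ Y) = _root_.tensorTrace R τ (D.tensor A Y) := by
  induction Y using TensorProduct.induction_on with
  | zero => simp
  | add Y Y' hY hY' => simp only [map_add, hY, hY']
  | tmul r a => simp

theorem Derivation.tensorTrace_pow_succ (D : Derivation K R R) (τ : A →ₗ[K] K)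
    (hτ : ∀ a b, τ (a * b) = τ (b * a)) (Z : R ⊗[K] A) (m : ℕ) :
    D (_root_.tensorTrace R τ (Z ^ (m + 1))) =
      (m + 1 : ℕ) • _root_.tensorTrace R τ (Z ^ m * D.tensor A Z) := by
  -- A spare factor `B` commuting with `Z` is carried along so that the induction can move powers of
  -- `Z` around cyclically under the trace.
  have key : ∀ (m : ℕ) (B : R ⊗[K] A), Commute B Z →
      _root_.tensorTrace R τ (B * D.tensor A (Z ^ (m + 1))) =
        (m + 1 : ℕ) • _root_.tensorTrace R τ (B * (Z ^ m * D.tensor A Z)) := by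
    intro m
    induction m with
    | zero => intro B _; simp
    | succ m ih =>
      intro B hB
      rw [pow_succ, D.tensor_mul, mul_add, map_add, ← mul_assoc, tensorTrace_mul_comm τ hτ _ Z,
        ← mul_assoc, ← hB.eq, ih (B * Z) (hB.mul_left (Commute.refl Z)), succ_nsmul (n := m + 1)]
      congr 3
      rw [mul_assoc, ← mul_assoc Z, ← pow_succ']
  rw [D.tensorTrace]
  simpa using key m 1 (Commute.one_left Z)

theorem lTensor_tensor_comm (D : Derivation K R R) (q : A →ₗ[K] A) (Y : R ⊗[K] A) :
    D.tensor A (LinearMap.lTensor R q Y) = LinearMap.lTensor R q (D.tensor A Y) := by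
  induction Y using TensorProduct.induction_on with
  | zero => simp
  | add Y Y' hY hY' => simp only [map_add, hY, hY']
  | tmul r a => simp

theorem lTensor_commutator (q : A →ₗ[K] A) (u : A)
    (hq : ∀ a, q (u * a - a * u) = u * q a - q a * u) (Y : R ⊗[K] A) :
    LinearMap.lTensor R q ((1 ⊗ₜ u) * Y - Y * (1 ⊗ₜ u)) =
      (1 ⊗ₜ u) * LinearMap.lTensor R q Y - LinearMap.lTensor R q Y * (1 ⊗ₜ u) := by
  induction Y using TensorProduct.induction_on with
  | zero => simp
  | add Y Y' hY hY' =>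
    simp only [map_add, mul_add, add_mul, map_sub] at hY hY' ⊢
    rw [add_sub_add_comm, hY, hY']
    abel
  | tmul r a =>
    simp only [Algebra.TensorProduct.tmul_mul_tmul, one_mul, mul_one, LinearMap.lTensor_tmul,
      ← TensorProduct.tmul_sub, hq]

/-- Evaluation of an element of `R ⊗ A` at a `K`-point of `R`. -/
noncomputable def tensorEval (A : Type*) [Ring A] [Algebra K A] (φ : R →ₐ[K] K) :
    R ⊗[K] A →ₐ[K] A :=
  Algebra.TensorProduct.lift ((Algebra.ofId K A).comp φ) (AlgHom.id K A)
    fun r _ => Algebra.commutes (φ r) _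

@[simp]
theorem tensorEval_tmul (φ : R →ₐ[K] K) (r : R) (a : A) :
    tensorEval A φ (r ⊗ₜ a) = φ r • a := by
  rw [Algebra.smul_def]
  exact Algebra.TensorProduct.lift_tmul _ _ _ _ _

theorem tensorEval_lTensor (φ : R →ₐ[K] K) (q : A →ₗ[K] A) (Y : R ⊗[K] A) :
    tensorEval A φ (LinearMap.lTensor R q Y) = q (tensorEval A φ Y) := by
  induction Y using TensorProduct.induction_on with
  | zero => simp
  | add Y Y' hY hY' => simp only [map_add, hY, hY']
  | tmul r a => simp

theorem algHom_tensorTrace (φ : R →ₐ[K] K) (τ : A →ₗ[K] K) (Y : R ⊗[K] A) :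
    φ (tensorTrace R τ Y) = τ (tensorEval A φ Y) := by
  induction Y using TensorProduct.induction_on with
  | zero => simp
  | add Y Y' hY hY' => simp only [map_add, hY, hY']
  | tmul r a => simp [mul_comm]

end TensorEnd

/-! ### Adjoint-invariant polynomials are determined on a Cartan subalgebra -/

namespace MvPolynomial

variable {K ι : Type*} [Field K] [Fintype ι]

theorem mkDerivation_apply_eq_sum (f : ι → MvPolynomial ι K) (P : MvPolynomial ι K) :
    mkDerivation K f P = ∑ i, pderiv i P * f i := by
  classical
  induction P using MvPolynomial.induction_on with
  | C a => simp
  | add p q hp hq => simp only [map_add, hp, hq, add_mul, Finset.sum_add_distrib]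
  | mul_X p j hp =>
    rw [Derivation.leibniz, hp, mkDerivation_X]
    simp only [Derivation.leibniz, pderiv_X, smul_eq_mul, add_mul, Finset.sum_add_distrib,
      Finset.mul_sum]
    congr 1
    · rw [Finset.sum_eq_single j]
      · simp
      · intro i _ hi
        simp [hi.symm]
      · simp
    · exact Finset.sum_congr rfl fun i _ => by ring

theorem IsHomogeneous.eval_smul {σ : Type*} {P : MvPolynomial σ K} {n : ℕ}
    (hP : P.IsHomogeneous n) (t : K) (f : σ → K) : eval (t • f) P = t ^ n * eval f P := by
  rw [eval_eq, eval_eq, Finset.mul_sum]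
  refine Finset.sum_congr rfl fun s hs => ?_
  have h1 : ∑ i ∈ s.support, s i = n := by
    have := hP (mem_support_iff.1 hs)
    rw [Finsupp.weight_apply] at this
    simpa [Finsupp.sum] using this
  simp only [Pi.smul_apply, smul_eq_mul, mul_pow, Finset.prod_mul_distrib]
  rw [Finset.prod_pow_eq_pow_sum, h1]
  ring

theorem derivative_aeval (f : ι → Polynomial K) (P : MvPolynomial ι K) :
    Polynomial.derivative (aeval f P) =
      ∑ i, aeval f (pderiv i P) * Polynomial.derivative (f i) := by
  classical
  induction P using MvPolynomial.induction_on with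
  | C a => simp
  | add p q hp hq => simp only [map_add, hp, hq, add_mul, Finset.sum_add_distrib]
  | mul_X p j hp =>
    rw [map_mul, Polynomial.derivative_mul, hp, aeval_X]
    simp only [Derivation.leibniz, pderiv_X, smul_eq_mul, map_add, map_mul, aeval_X, add_mul,
      Finset.sum_add_distrib]
    rw [add_comm]
    congr 1
    · rw [Finset.sum_eq_single j]
      · simp
      · intro i _ hi
        simp [hi.symm]
      · simp
    · rw [Finset.sum_mul]
      exact Finset.sum_congr rfl fun i _ => by ring

end MvPolynomial

section Vanishing

open MvPolynomial Module

variable {K L ι : Type*} [Field K] [CharZero K] [LieRing L] [LieAlgebra K L] [Fintype ι]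

/-- The derivation of polynomial functions of `z ∈ L` given by the vector field
`z ↦ ⁅u, a + z⁆`. -/
noncomputable def adjointDerivation (b : Basis ι K L) (a u : L) :
    Derivation K (MvPolynomial ι K) (MvPolynomial ι K) :=
  mkDerivation K fun i => C (b.repr ⁅u, a⁆ i) + ∑ j, C (b.repr ⁅u, b j⁆ i) * X j

omit [Fintype ι] in
theorem eval_homogeneousComponent_eq_zero_of_submodule (b : Basis ι K L) (H : Submodule K L)
    (P : MvPolynomial ι K) (hH : ∀ w ∈ H, eval (b.repr w) P = 0) (N : ℕ) (w : L) (hw : w ∈ H) :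
    eval (b.repr w) (homogeneousComponent N P) = 0 := by
  let q : Polynomial K := ∑ m ∈ Finset.range (P.totalDegree + 1),
    Polynomial.C (eval (b.repr w) (homogeneousComponent m P)) * Polynomial.X ^ m
  have hq : q = 0 := by
    refine Polynomial.funext fun t => ?_
    have h1 := hH (t • w) (H.smul_mem t hw)
    rw [← sum_homogeneousComponent P, map_sum] at h1
    rw [Polynomial.eval_zero, ← h1, Polynomial.eval_finsetSum]
    refine Finset.sum_congr rfl fun m _ => ?_
    have h2 : ⇑(b.repr (t • w)) = t • ⇑(b.repr w) := by simp
    rw [h2, (homogeneousComponent_isHomogeneous m P).eval_smul, Polynomial.eval_mul,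
      Polynomial.eval_C, Polynomial.eval_pow, Polynomial.eval_X, mul_comm]
  by_cases hN : N < P.totalDegree + 1
  · have h1 := congrArg (Polynomial.coeff · N) hq
    simp only [q, Polynomial.finsetSum_coeff, Polynomial.coeff_C_mul, Polynomial.coeff_X_pow,
      Polynomial.coeff_zero] at h1
    rw [Finset.sum_eq_single N] at h1
    · simpa using h1
    · intro m _ hm
      simp [hm.symm]
    · intro h
      exact absurd (Finset.mem_range.2 hN) h
  · rw [homogeneousComponent_eq_zero _ _ (by omega), map_zero]

/-- A polynomial function on `L` that is invariant under the adjoint action and vanishes on `H`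
is zero, if `⁅L, a⁆ + H = L` for some `a ∈ H`. (The origin of the coordinates is at `a`.) -/
theorem eq_zero_of_adjointDerivation_eq_zero (b : Basis ι K L) (a : L) (H : Submodule K L)
    (hsum : ∀ z : L, ∃ u : L, ∃ w ∈ H, z = ⁅u, a⁆ + w) (P : MvPolynomial ι K)
    (hD : ∀ u : L, adjointDerivation b a u P = 0) (hH : ∀ w ∈ H, eval (b.repr w) P = 0) :
    P = 0 := by
  suffices h : ∀ N, homogeneousComponent N P = 0 by
    rw [← sum_homogeneousComponent P]
    exact Finset.sum_eq_zero fun N _ => h N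
  intro N
  induction N using Nat.strong_induction_on with
  | _ N ih =>
  -- The field `z ↦ ⁅u, a + z⁆` has a constant part, which lowers degree by one, and a linear part,
  -- which preserves it. As the components of `P` below `N` vanish, the degree `N - 1` part of `D P
  -- = 0` says that the component of degree `N` has zero derivative along `⁅u, a⁆`.
  have hDc : ∀ u : L, ∑ i, pderiv i (homogeneousComponent N P) * C (b.repr ⁅u, a⁆ i) = 0 := by
    intro u
    rcases Nat.eq_zero_or_pos N with rfl | hN
    · simp
    by_cases hNP : N < P.totalDegree + 1
    swap
    · rw [homogeneousComponent_eq_zero _ _ (by omega)]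
      simp
    have h1 := hD u
    have hC : ∀ m, 1 ≤ m → (∑ i, pderiv i (homogeneousComponent m P) *
        C (b.repr ⁅u, a⁆ i)).IsHomogeneous (m - 1) := fun m _ =>
      IsHomogeneous.sum _ _ _ fun i _ => by
        have := ((homogeneousComponent_isHomogeneous m P).pderiv (i := i)).mul
          (isHomogeneous_C ι (b.repr ⁅u, a⁆ i))
        simpa using this
    have hL : ∀ m, 1 ≤ m → (∑ i, pderiv i (homogeneousComponent m P) *
        ∑ j, C (b.repr ⁅u, b j⁆ i) * X j).IsHomogeneous m := fun m hm =>
      IsHomogeneous.sum _ _ _ fun i _ => by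
        have h2 : (∑ j, C (b.repr ⁅u, b j⁆ i) * X j : MvPolynomial ι K).IsHomogeneous 1 :=
          IsHomogeneous.sum _ _ _ fun j _ => by
            simpa using (isHomogeneous_C ι (b.repr ⁅u, b j⁆ i)).mul (isHomogeneous_X K j)
        have := ((homogeneousComponent_isHomogeneous m P).pderiv (i := i)).mul h2
        rwa [Nat.sub_add_cancel hm] at this
    rw [← sum_homogeneousComponent P, map_sum] at h1
    have h2 := congrArg (homogeneousComponent (N - 1)) h1
    rw [map_sum, map_zero, Finset.sum_eq_single N] at h2
    · rw [adjointDerivation, mkDerivation_apply_eq_sum] at h2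
      simp only [mul_add, Finset.sum_add_distrib, map_add] at h2
      rwa [homogeneousComponent_of_mem (hC N hN), homogeneousComponent_of_mem (hL N hN),
        if_pos rfl, if_neg (by omega), add_zero] at h2
    · intro m _ hm
      rcases lt_or_gt_of_ne hm with hm | hm
      · rw [ih m hm]
        simp
      · rw [adjointDerivation, mkDerivation_apply_eq_sum]
        simp only [mul_add, Finset.sum_add_distrib, map_add]
        rw [homogeneousComponent_of_mem (hC m (by omega)),
          homogeneousComponent_of_mem (hL m (by omega)), if_neg (by omega), if_neg (by omega),
          add_zero]
    · intro h
      exact absurd (Finset.mem_range.2 hNP) h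
  have hHN := eval_homogeneousComponent_eq_zero_of_submodule b H P hH N
  refine MvPolynomial.funext fun z => ?_
  -- The component is constant on the line through `w` in the direction `⁅u, a⁆`, which joins `w ∈
  -- H` to the given point; on `H` it vanishes.
  obtain ⟨u, w, hw, hz⟩ := hsum (b.equivFun.symm z)
  let f : ι → Polynomial K := fun i =>
    Polynomial.C (b.repr w i) + Polynomial.C (b.repr ⁅u, a⁆ i) * Polynomial.X
  let q : Polynomial K := aeval f (homogeneousComponent N P)
  have hq : Polynomial.derivative q = 0 := by
    rw [derivative_aeval]
    have := congrArg (aeval f) (hDc u)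
    rw [map_sum, map_zero] at this
    rw [← this]
    refine Finset.sum_congr rfl fun i _ => ?_
    simp [f]
  have hev : ∀ t : K, q.eval t = eval (b.repr (w + t • ⁅u, a⁆)) (homogeneousComponent N P) := by
    intro t
    have : (Polynomial.evalRingHom t) q = _ := rfl
    rw [← Polynomial.coe_evalRingHom]
    simp only [q]
    rw [aeval_def, MvPolynomial.hom_eval₂, ← eval₂_id (p := homogeneousComponent N P)]
    congr 1
    · ext r; simp
    · ext i
      simp only [f, Polynomial.coe_evalRingHom, Polynomial.eval_mul,
        Polynomial.eval_C, Polynomial.eval_X, map_add, map_smul, Finsupp.add_apply,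
        Finsupp.smul_apply, smul_eq_mul]
      ring
  have hconst : q.eval 1 = q.eval 0 := by
    rw [Polynomial.eq_C_of_derivative_eq_zero hq]
    simp
  rw [hev, hev, zero_smul, add_zero, hHN w hw, one_smul, add_comm, ← hz] at hconst
  rw [map_zero, ← hconst]
  congr 2
  ext i
  rw [← b.equivFun_apply, LinearEquiv.apply_symm_apply]

end Vanishing

/-! ### Generic elements and their invariants -/

section InvariantPolynomials

open MvPolynomial Module

section GenericElement

open TensorProduct

variable {K L ι : Type*} [Field K] [LieRing L] [LieAlgebra K L] [Fintype ι]

theorem adjointDerivation_X (b : Basis ι K L) (a u : L) (i : ι) :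
    adjointDerivation b a u (X i) =
      C (b.repr ⁅u, a⁆ i) + ∑ j, C (b.repr ⁅u, b j⁆ i) * X j := by
  rw [adjointDerivation, mkDerivation_X]

variable {m : Type*} [Fintype m] [DecidableEq m]

/-- The matrix of `a + z` in a representation `ρ`, as a polynomial in the coordinates of `z`. -/
noncomputable def genericMatrix (b : Basis ι K L) (ρ : L →ₗ[K] Matrix m m K) (a : L) :
    Matrix m m (MvPolynomial ι K) :=
  (C : K →+* MvPolynomial ι K).mapMatrix (ρ a) +
    ∑ j, (X j : MvPolynomial ι K) • (C : K →+* MvPolynomial ι K).mapMatrix (ρ (b j))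

theorem genericMatrix_apply (b : Basis ι K L) (ρ : L →ₗ[K] Matrix m m K) (a : L) (k l : m) :
    genericMatrix b ρ a k l = C (ρ a k l) + ∑ j, X j * C (ρ (b j) k l) := by
  simp [genericMatrix, Matrix.sum_apply]

omit [Fintype m] [DecidableEq m] in
theorem sum_repr_mul_apply (b : Basis ι K L) (ρ : L →ₗ[K] Matrix m m K) (w : L) (k l : m) :
    ρ w k l = ∑ j, b.repr w j * ρ (b j) k l := by
  conv_lhs => rw [← b.sum_repr w]
  simp only [map_sum, map_smul, Matrix.sum_apply, Matrix.smul_apply, smul_eq_mul]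

theorem map_eval_genericMatrix (b : Basis ι K L) (ρ : L →ₗ[K] Matrix m m K) (a w : L) :
    (genericMatrix b ρ a).map (eval (b.repr w)) = ρ (a + w) := by
  ext k l
  rw [Matrix.map_apply, genericMatrix_apply, map_add ρ, Matrix.add_apply,
    sum_repr_mul_apply b ρ w]
  simp

theorem map_adjointDerivation_genericMatrix (b : Basis ι K L) (ρ : L →ₗ[K] Matrix m m K)
    (hρ : ∀ u w, ρ ⁅u, w⁆ = ρ u * ρ w - ρ w * ρ u) (a u : L) :
    (genericMatrix b ρ a).map (adjointDerivation b a u) =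
      (C : K →+* MvPolynomial ι K).mapMatrix (ρ u) * genericMatrix b ρ a -
        genericMatrix b ρ a * (C : K →+* MvPolynomial ι K).mapMatrix (ρ u) := by
  have h1 : (C : K →+* MvPolynomial ι K).mapMatrix (ρ u) * genericMatrix b ρ a -
        genericMatrix b ρ a * (C : K →+* MvPolynomial ι K).mapMatrix (ρ u) =
      (C : K →+* MvPolynomial ι K).mapMatrix (ρ ⁅u, a⁆) +
        ∑ j, (X j : MvPolynomial ι K) •
          (C : K →+* MvPolynomial ι K).mapMatrix (ρ ⁅u, b j⁆) := by
    simp only [hρ, map_sub, map_mul, smul_sub, Finset.sum_sub_distrib, genericMatrix, mul_add,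
      add_mul, Finset.mul_sum, Finset.sum_mul, mul_smul_comm, smul_mul_assoc]
    abel
  rw [h1]
  ext k l : 1
  have h2 : ∀ w : L, (C (ρ w k l) : MvPolynomial ι K) =
      ∑ j, C (b.repr w j) * C (ρ (b j) k l) := by
    intro w
    rw [sum_repr_mul_apply b ρ w, map_sum]
    simp only [map_mul]
  simp only [Matrix.map_apply, genericMatrix_apply, map_add, map_sum, Derivation.leibniz,
    derivation_C, adjointDerivation_X, smul_eq_mul, mul_zero, zero_add, Matrix.add_apply,
    Matrix.sum_apply, Matrix.smul_apply, RingHom.mapMatrix_apply]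
  rw [h2]
  simp only [h2 ⁅u, b _⁆, mul_add, Finset.sum_add_distrib, Finset.mul_sum]
  congr 1
  · exact Finset.sum_congr rfl fun _ _ => mul_comm _ _
  · rw [Finset.sum_comm]
    exact Finset.sum_congr rfl fun _ _ => Finset.sum_congr rfl fun _ _ => by ring

variable {A : Type*} [Ring A] [Algebra K A]

/-- The element `a + z` of `A`, with polynomial dependence on the coordinates of `z`. -/
noncomputable def genericElement (b : Basis ι K L) (f : L →ₗ[K] A) (a : L) :
    MvPolynomial ι K ⊗[K] A :=
  1 ⊗ₜ f a + ∑ i, (X i : MvPolynomial ι K) ⊗ₜ f (b i)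

theorem sum_repr_smul_map (b : Basis ι K L) (f : L →ₗ[K] A) (w : L) :
    f w = ∑ i, b.repr w i • f (b i) := by
  conv_lhs => rw [← b.sum_repr w]
  simp only [map_sum, map_smul]

theorem tensorEval_genericElement (b : Basis ι K L) (f : L →ₗ[K] A) (a w : L) :
    tensorEval A (aeval (b.repr w)) (genericElement b f a) = f (a + w) := by
  rw [map_add f, sum_repr_smul_map b f w]
  simp [genericElement]

theorem tensor_adjointDerivation_genericElement (b : Basis ι K L) (f : L →ₗ[K] A)
    (hf : ∀ u w, f ⁅u, w⁆ = f u * f w - f w * f u) (a u : L) :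
    (adjointDerivation b a u).tensor A (genericElement b f a) =
      (1 ⊗ₜ f u) * genericElement b f a - genericElement b f a * (1 ⊗ₜ f u) := by
  have h1 : (1 ⊗ₜ f u) * genericElement b f a - genericElement b f a * (1 ⊗ₜ f u) =
      (1 : MvPolynomial ι K) ⊗ₜ f ⁅u, a⁆ +
        ∑ j, (X j : MvPolynomial ι K) ⊗ₜ f ⁅u, b j⁆ := by
    simp only [genericElement, mul_add, add_mul, Finset.mul_sum, Finset.sum_mul,
      Algebra.TensorProduct.tmul_mul_tmul, one_mul, mul_one, TensorProduct.tmul_sub,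
      Finset.sum_sub_distrib, hf]
    abel
  have h2 : ∀ (w : L) (P : MvPolynomial ι K),
      P ⊗ₜ[K] f w = ∑ j, (C (b.repr w j) * P) ⊗ₜ[K] f (b j) := by
    intro w P
    conv_lhs => rw [sum_repr_smul_map b f w, TensorProduct.tmul_sum]
    exact Finset.sum_congr rfl fun j _ => by
      rw [← MvPolynomial.smul_eq_C_mul, TensorProduct.smul_tmul]
  rw [h1, h2]
  simp only [h2 ⁅u, b _⁆]
  simp only [genericElement, map_add, map_sum, Derivation.tensor_tmul,
    Derivation.map_one_eq_zero, TensorProduct.zero_tmul, zero_add, adjointDerivation_X,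
    TensorProduct.add_tmul, TensorProduct.sum_tmul, Finset.sum_add_distrib, mul_one]
  rw [Finset.sum_comm]

/-- `D` acts on `Z`, and by equivariance of `q` on the whole product, as the commutator with `1 ⊗
u`; the trace of a commutator is zero. -/
theorem derivation_tensorTrace_eq_zero {R : Type*} [CommRing R] [Algebra K R]
    (D : Derivation K R R) (τ : A →ₗ[K] K) (hτ : ∀ x y, τ (x * y) = τ (y * x)) (q : A →ₗ[K] A)
    (u : A) (hq : ∀ x, q (u * x - x * u) = u * q x - q x * u) {Z : R ⊗[K] A}
    (hZ : D.tensor A Z = (1 ⊗ₜ u) * Z - Z * (1 ⊗ₜ u)) (r s : ℕ) :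
    D (tensorTrace R τ (LinearMap.lTensor R q (Z ^ r) * Z ^ s)) = 0 := by
  have key : ∀ U P Q : R ⊗[K] A,
      (U * P - P * U) * Q + P * (U * Q - Q * U) = U * (P * Q) - (P * Q) * U := by
    intro U P Q
    noncomm_ring
  rw [D.tensorTrace, D.tensor_mul, lTensor_tensor_comm, D.tensor_pow_of_commutator hZ,
    D.tensor_pow_of_commutator hZ, lTensor_commutator q u hq, key, map_sub,
    tensorTrace_mul_comm τ hτ, sub_self]

end GenericElement

namespace LieAlgebra.IsKilling

variable {K L : Type*} [Field K] [CharZero K] [IsAlgClosed K] [LieRing L] [LieAlgebra K L]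
  [FiniteDimensional K L] [LieAlgebra.IsKilling K L]
  (H : LieSubalgebra K L) [H.IsCartanSubalgebra]

omit [LieAlgebra.IsKilling K L] in
theorem exists_forall_root_apply_ne_zero : ∃ a : H, ∀ α ∈ H.root, α a ≠ 0 := by
  obtain ⟨a, ha⟩ := Module.Dual.exists_forall_ne_zero_of_forall_exists
    (f := fun α : H.root => (LieModule.Weight.toLinear K H L (α : LieModule.Weight K H L))) (by
      rintro ⟨α, hα⟩
      by_contra! h
      have h1 : (α : LieModule.Weight K H L).IsNonZero := by simpa using hα
      exact h1 (funext fun x => h x))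
  exact ⟨a, fun α hα => ha ⟨α, hα⟩⟩

/-- A regular element acts invertibly on every root space, so the root spaces lie in the image of
`ad a` and `H` fills the rest. This supplies the transversality needed for the vanishing principle.
-/
theorem exists_eq_lie_add_of_root_apply_ne_zero {a : H} (ha : ∀ α ∈ H.root, α a ≠ 0) (z : L) :
    ∃ u : L, ∃ w ∈ H.toSubmodule, z = ⁅u, (a : L)⁆ + w := by
  let S : Submodule K L := LinearMap.range (LieAlgebra.ad K L (a : L)) ⊔ H.toSubmodule
  have hS : S = ⊤ := by
    have h1 := LieAlgebra.cartan_sup_iSup_rootSpace_eq_top (K := K) (L := L) (H := H)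
    have h2 : (⊤ : Submodule K L) = ((H.toLieSubmodule ⊔ ⨆ α : LieModule.Weight K H L,
        ⨆ (_ : α.IsNonZero), LieAlgebra.rootSpace H α : LieSubmodule K H L) : Submodule K L) := by
      rw [h1]; rfl
    rw [eq_top_iff, h2]
    simp only [LieSubmodule.sup_toSubmodule, LieSubmodule.iSup_toSubmodule]
    refine sup_le le_sup_right (iSup_le fun α => iSup_le fun hα => ?_)
    intro x hx
    have h3 := lie_eq_smul_of_mem_rootSpace hx a
    have h4 : α a ≠ 0 := ha α (by simpa using hα)
    refine Submodule.mem_sup_left ⟨(α a)⁻¹ • x, ?_⟩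
    have h5 : ⁅(a : L), x⁆ = α a • x := h3
    rw [LieAlgebra.ad_apply, lie_smul, h5, smul_smul, inv_mul_cancel₀ h4, one_smul]
  have hz : z ∈ S := hS ▸ Submodule.mem_top
  obtain ⟨_, ⟨u, rfl⟩, w, hw, rfl⟩ := Submodule.mem_sup.1 hz
  exact ⟨-u, w, hw, by rw [LieAlgebra.ad_apply, neg_lie, lie_skew]⟩

/-- The dimension of a Cartan subalgebra is at most the nullity of any element. -/
theorem finrank_cartan_le_finrank_maxGenEigenspace (z : L) :
    finrank K H ≤ finrank K (Module.End.maxGenEigenspace (LieAlgebra.ad K L z) 0) := by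
  classical
  obtain ⟨a, ha⟩ := exists_forall_root_apply_ne_zero H
  let b := Module.finBasis K L
  let ρ : L →ₗ[K] Matrix (Fin (finrank K L)) (Fin (finrank K L)) K :=
    (LinearMap.toMatrix b b).toLinearMap ∘ₗ (LieAlgebra.ad K L : L →ₗ[K] Module.End K L)
  have hρ : ∀ u w : L, ρ ⁅u, w⁆ = ρ u * ρ w - ρ w * ρ u := by
    intro u w
    simp only [ρ, LinearMap.comp_apply, LinearEquiv.coe_coe, LieHom.coe_toLinearMap]
    rw [LieHom.map_lie, Ring.lie_def, map_sub, LinearMap.toMatrix_mul, LinearMap.toMatrix_mul]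
  obtain ⟨M, hMdef⟩ : ∃ M, M = genericMatrix b ρ a := ⟨_, rfl⟩
  have hM : ∀ w : L, M.map (eval (b.repr w)) = ρ (a + w) := fun w =>
    hMdef ▸ map_eval_genericMatrix b ρ a w
  have hchar : ∀ (w : L) (i : ℕ), eval (b.repr w) (M.charpoly.coeff i) =
      (LieAlgebra.ad K L (a + w)).charpoly.coeff i := by
    intro w i
    rw [← LinearMap.charpoly_toMatrix _ b]
    change _ = (ρ (a + w)).charpoly.coeff i
    rw [← hM, Matrix.charpoly_map, Polynomial.coeff_map]
  have hH : ∀ w ∈ H, finrank K H ≤ (LieAlgebra.ad K L w).charpoly.natTrailingDegree := by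
    intro w hw
    rw [← LinearMap.finrank_maxGenEigenspace_zero_eq]
    refine Submodule.finrank_mono (s := H.toSubmodule) fun x hx => ?_
    rw [Module.End.mem_maxGenEigenspace]
    refine ⟨1, ?_⟩
    have : ⁅(⟨w, hw⟩ : H), (⟨x, hx⟩ : H)⁆ = 0 := trivial_lie_zero _ _ _ _
    simpa using congrArg Subtype.val this
  -- The coefficients of the characteristic polynomial of `ad` are invariant. Those below `dim H`
  -- vanish on `H`, because the abelian `H` lies in the kernel of `ad w` for `w ∈ H`; hence they
  -- vanish everywhere.
  have hzero : ∀ i < finrank K H, M.charpoly.coeff i = 0 := by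
    intro i hi
    refine eq_zero_of_adjointDerivation_eq_zero b (a : L) H.toSubmodule
      (exists_eq_lie_add_of_root_apply_ne_zero H ha) _ (fun u => ?_) (fun w hw => ?_)
    · refine Matrix.derivation_charpoly_coeff _ M
        ((C : K →+* MvPolynomial (Fin (finrank K L)) K).mapMatrix (ρ u)) ?_ i
      rw [hMdef]
      exact map_adjointDerivation_genericMatrix b ρ hρ (a : L) u
    · rw [hchar]
      exact Polynomial.coeff_eq_zero_of_lt_natTrailingDegree
        (hi.trans_le (hH _ (H.add_mem a.2 hw)))
  rw [LinearMap.finrank_maxGenEigenspace_zero_eq]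
  refine Polynomial.le_natTrailingDegree (LinearMap.charpoly_monic _).ne_zero fun i hi => ?_
  have := hchar (z - a) i
  rw [hzero i hi, map_zero, add_sub_cancel] at this
  exact this.symm

end LieAlgebra.IsKilling

open TrivSqZeroExt in
theorem Matrix.derivation_det_eq_zero {K R m : Type*} [CommRing K] [CommRing R] [Algebra K R]
    [Fintype m] [DecidableEq m] (D : Derivation K R R) (M : Matrix m m R)
    (h : ∀ i j, D (M i j) = 0) : D M.det = 0 := by
  have h1 : M.map (ofDerivation D) = M.map (inlHom R R) := by
    ext i j <;> simp [ofDerivation, h]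
  have h2 : ofDerivation D M.det = inlHom R R M.det := by
    rw [RingHom.map_det, RingHom.map_det]
    exact congrArg _ h1
  simpa [ofDerivation] using congrArg snd h2

namespace LieSubalgebra

open TensorProduct

variable {K V : Type*} [Field K] [CharZero K] [IsAlgClosed K] [AddCommGroup V] [Module K V]
  [FiniteDimensional K V] {g : LieSubalgebra K (Module.End K V)} [LieAlgebra.IsSemisimple K g]

/-- If a Gram determinant of the projections of powers of `h ∈ g` is nonzero, then so is that of
some element of any given Cartan subalgebra. -/
theorem exists_gram_det_ne_zero (H : LieSubalgebra K g) [H.IsCartanSubalgebra]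
    {p : Module.End K V →ₗ[K] g}
    (hp : ∀ a (w : g),
      LinearMap.trace K V ((p a : Module.End K V) * w) = LinearMap.trace K V (a * w))
    {m : Type*} [Fintype m] [DecidableEq m] (E : m → ℕ) (h : g)
    (hdet : (Matrix.of fun r s : m => LinearMap.trace K V
      ((p ((h : Module.End K V) ^ E r) : Module.End K V) * (h : Module.End K V) ^ E s)).det ≠ 0) :
    ∃ c : H, (Matrix.of fun r s : m => LinearMap.trace K V
      ((p (((c : g) : Module.End K V) ^ E r) : Module.End K V) *
        ((c : g) : Module.End K V) ^ E s)).det ≠ 0 := by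
  by_contra! hH
  have hH' : ∀ c ∈ H, (Matrix.of fun r s : m => LinearMap.trace K V
      ((p ((c : Module.End K V) ^ E r) : Module.End K V) *
        (c : Module.End K V) ^ E s)).det = 0 := fun c hc => hH ⟨c, hc⟩
  obtain ⟨a, ha⟩ := LieAlgebra.IsKilling.exists_forall_root_apply_ne_zero H
  let b := Module.finBasis K g
  let q : Module.End K V →ₗ[K] Module.End K V := g.toSubmodule.subtype ∘ₗ p
  let τ : Module.End K V →ₗ[K] K := LinearMap.trace K V
  let f : g →ₗ[K] Module.End K V := g.toSubmodule.subtype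
  have hf : ∀ u w, f ⁅u, w⁆ = f u * f w - f w * f u := fun u w => rfl
  obtain ⟨Z, hZdef⟩ : ∃ Z, Z = genericElement b f (a : g) := ⟨_, rfl⟩
  have hDZ : ∀ u : g, (adjointDerivation b (a : g) u).tensor (Module.End K V) Z =
      (1 ⊗ₜ f u) * Z - Z * (1 ⊗ₜ f u) := fun u =>
    hZdef ▸ tensor_adjointDerivation_genericElement b f hf (a : g) u
  have hτ : ∀ x y : Module.End K V, τ (x * y) = τ (y * x) := fun x y => LinearMap.trace_mul_comm K x y
  have hq : ∀ (u : g) (x : Module.End K V), q (f u * x - x * f u) = f u * q x - q x * f u := by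
    intro u x
    have := congrArg Subtype.val (projection_lie hp u x)
    rw [Ring.lie_def, LieSubalgebra.coe_bracket, Ring.lie_def] at this
    exact this
  -- The Gram matrix at the generic point `a + z`. Its determinant is an invariant polynomial, so if
  -- it vanished on `H` it would vanish at `h` too.
  let G : Matrix m m (MvPolynomial (Fin (finrank K g)) K) := Matrix.of fun r s =>
    tensorTrace _ τ (LinearMap.lTensor _ q (Z ^ E r) * Z ^ E s)
  have hDG : ∀ u : g, adjointDerivation b (a : g) u G.det = 0 := by
    intro u
    refine Matrix.derivation_det_eq_zero _ _ fun r s => ?_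
    exact derivation_tensorTrace_eq_zero _ τ hτ q (f u) (hq u) (hDZ u) _ _
  have hZ : ∀ w : g, tensorEval (Module.End K V) (aeval (b.repr w)) Z =
      (((a : g) + w : g) : Module.End K V) := fun w =>
    hZdef ▸ tensorEval_genericElement b f (a : g) w
  have hG : ∀ w : g, eval (b.repr w) G.det = (Matrix.of fun r s : m => LinearMap.trace K V
      ((p ((((a : g) + w : g) : Module.End K V) ^ E r) : Module.End K V) *
        (((a : g) + w : g) : Module.End K V) ^ E s)).det := by
    intro w
    rw [RingHom.map_det]
    congr 1
    ext r s
    simp only [G, RingHom.mapMatrix_apply, Matrix.map_apply, Matrix.of_apply]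
    rw [← MvPolynomial.aeval_eq_eval, algHom_tensorTrace, map_mul, tensorEval_lTensor, map_pow (tensorEval _ _), map_pow (tensorEval _ _), hZ]
    rfl
  have hzero : G.det = 0 := by
    refine eq_zero_of_adjointDerivation_eq_zero b (a : g) H.toSubmodule
      (LieAlgebra.IsKilling.exists_eq_lie_add_of_root_apply_ne_zero H ha) _ hDG fun w hw => ?_
    rw [hG]
    exact hH' _ (H.add_mem a.2 hw)
  apply hdet
  have := hG (h - a)
  rw [hzero, map_zero, add_sub_cancel] at this
  exact this.symm

end LieSubalgebra

end InvariantPolynomials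

/-! ### The Gram determinant at `h` and its transfer to a Cartan subalgebra -/

namespace IsCyclicSl2

open Module LieModule

variable {K V : Type*} [Field K] [CharZero K] [AddCommGroup V] [Module K V]
  {g : LieSubalgebra K (Module.End K V)} {d : ℕ}
  {e : Basis (Fin (d + 1)) K V} {v : V} {x h y : Module.End K V}
  (T : IsCyclicSl2 g e v x h y)

include T

omit [CharZero K] in
theorem h_apply (i : Fin (d + 1)) : h (e i) = (2 * ((i : ℕ) : K) - d) • e i := by
  rw [T.basis_apply, T.h_pow]

omit [CharZero K] in
theorem repr_h_apply (w : V) (j : Fin (d + 1)) :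
    e.repr (h w) j = (2 * ((j : ℕ) : K) - d) * e.repr w j := by
  conv_lhs => rw [← e.sum_repr w]
  simp only [map_sum, map_smul, T.h_apply, Finsupp.coe_finsetSum, Finset.sum_apply,
    Finsupp.smul_apply, Basis.repr_self, smul_eq_mul]
  rw [Finset.sum_eq_single j]
  · simp [mul_comm]
  · intro i _ hi
    simp [hi]
  · simp

omit [CharZero K] in
theorem repr_lie_h_apply (a : Module.End K V) (i j : Fin (d + 1)) :
    e.repr (⁅h, a⁆ (e i)) j = (2 * ((j : ℕ) - (i : ℕ) : K)) * e.repr (a (e i)) j := by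
  rw [Ring.lie_def, LinearMap.sub_apply, Module.End.mul_apply, Module.End.mul_apply, map_sub,
    Finsupp.sub_apply, T.repr_h_apply, T.h_apply, map_smul, map_smul, Finsupp.smul_apply,
    smul_eq_mul]
  ring

-- In the basis `e`, the operator `ad h` multiplies the matrix entry `(j, i)` by `2 (j - i)`; being
-- diagonalizable, it has no generalized null vectors beyond its kernel.
omit [CharZero K] in
theorem lie_h_eq_zero_of_pow {N : ℕ} {a : Module.End K V}
    (ha : ((LieAlgebra.ad K (Module.End K V) h) ^ N) a = 0) : ⁅h, a⁆ = 0 := by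
  have key : ∀ (N : ℕ) (i j : Fin (d + 1)),
      e.repr ((((LieAlgebra.ad K (Module.End K V) h) ^ N) a) (e i)) j =
        (2 * ((j : ℕ) - (i : ℕ) : K)) ^ N * e.repr (a (e i)) j := by
    intro N i j
    induction N with
    | zero => simp
    | succ N ih =>
      rw [pow_succ', Module.End.mul_apply, LieAlgebra.ad_apply, T.repr_lie_h_apply, ih]
      ring
  refine e.ext fun i => e.repr.injective (Finsupp.ext fun j => ?_)
  have h1 := key N i j
  rw [ha] at h1
  rw [T.repr_lie_h_apply]
  simp only [LinearMap.zero_apply, map_zero, Finsupp.zero_apply] at h1 ⊢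
  rcases mul_eq_zero.1 h1.symm with h2 | h2
  · rw [eq_zero_of_pow_eq_zero h2, zero_mul]
  · rw [h2, mul_zero]

omit [CharZero K] in
theorem maxGenEigenspace_ad_le_ker :
    Module.End.maxGenEigenspace (LieAlgebra.ad K g ⟨h, T.h_mem⟩) 0 ≤
      LinearMap.ker (LieAlgebra.ad K g ⟨h, T.h_mem⟩) := by
  intro z hz
  rw [Module.End.mem_maxGenEigenspace] at hz
  obtain ⟨N, hN⟩ := hz
  rw [zero_smul, sub_zero] at hN
  have h1 : ∀ N : ℕ, ((((LieAlgebra.ad K g ⟨h, T.h_mem⟩) ^ N) z : g) : Module.End K V) =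
      ((LieAlgebra.ad K (Module.End K V) h) ^ N) z := by
    intro N
    induction N with
    | zero => simp
    | succ N ih =>
      rw [pow_succ', Module.End.mul_apply, pow_succ', Module.End.mul_apply, ← ih]
      rfl
  have h2 := h1 N
  rw [hN] at h2
  have h3 := T.lie_h_eq_zero_of_pow h2.symm
  rw [LinearMap.mem_ker]
  exact Subtype.ext h3

omit [CharZero K] in
theorem trace_mul_h_pow (a : Module.End K V) (m : ℕ) : LinearMap.trace K V (a * h ^ m) =
    ∑ i : Fin (d + 1), e.repr (a (e i)) i * (2 * ((i : ℕ) : K) - d) ^ m := by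
  have h1 : ∀ i, (h ^ m) (e i) = (2 * ((i : ℕ) : K) - d) ^ m • e i := by
    intro i
    induction m with
    | zero => simp
    | succ m ih =>
      rw [pow_succ', Module.End.mul_apply, ih, map_smul, T.h_apply, smul_smul, pow_succ]
  rw [LinearMap.trace_eq_matrix_trace K e, Matrix.trace]
  refine Finset.sum_congr rfl fun i _ => ?_
  rw [Matrix.diag_apply, LinearMap.toMatrix_apply, Module.End.mul_apply, h1, map_smul, map_smul,
    Finsupp.smul_apply, smul_eq_mul, mul_comm]

/-- The eigenvalues of `h` are distinct, so `a` is diagonal; the vanishing traces form a Vandermonde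
system for its diagonal. -/
theorem eq_zero_of_trace_mul_h_pow {a : Module.End K V} (ha : ⁅h, a⁆ = 0)
    (htr : ∀ m : ℕ, LinearMap.trace K V (a * h ^ m) = 0) : a = 0 := by
  have hinj : Function.Injective fun i : Fin (d + 1) => (2 * ((i : ℕ) : K) - d) := by
    intro i j hij
    simp only [sub_left_inj] at hij
    exact Fin.ext (Nat.cast_injective (mul_left_cancel₀ two_ne_zero hij))
  have h1 : (fun i : Fin (d + 1) => e.repr (a (e i)) i) = 0 :=
    Matrix.eq_zero_of_forall_pow_sum_mul_pow_eq_zero hinj fun m => by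
      rw [← T.trace_mul_h_pow]
      exact htr m
  refine e.ext fun i => e.repr.injective (Finsupp.ext fun j => ?_)
  simp only [LinearMap.zero_apply, map_zero, Finsupp.zero_apply]
  by_cases hij : j = i
  · rw [hij]
    exact congrFun h1 i
  · have h2 := T.repr_lie_h_apply a i j
    rw [ha] at h2
    simp only [LinearMap.zero_apply, map_zero, Finsupp.zero_apply] at h2
    refine (mul_eq_zero.1 h2.symm).resolve_left (mul_ne_zero two_ne_zero (sub_ne_zero.2 ?_))
    exact fun h => hij (Fin.ext (Nat.cast_injective h))

/-- By independence and the dimension bound, the `p (h ^ r)` form a basis of the centralizer `C` of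
`h` in `g`. A null vector of the Gram matrix gives `z ∈ C` orthogonal to `C`, so `tr (z h ^ m) = tr
(z p (h ^ m)) = 0` for all `m`, which forces `z = 0`. -/
theorem gram_det_ne_zero [FiniteDimensional K V] [LieAlgebra.IsSemisimple K g]
    (hd : d ≠ 0) (hsl : ∀ a ∈ g, LinearMap.trace K V a = 0)
    {p : Module.End K V →ₗ[K] g}
    (hp : ∀ a (w : g),
      LinearMap.trace K V ((p a : Module.End K V) * w) = LinearMap.trace K V (a * w)) :
    (Matrix.of fun r s : powExponents g x d => LinearMap.trace K V
      ((p (h ^ (r : ℕ)) : Module.End K V) * h ^ (s : ℕ))).det ≠ 0 := by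
  intro hdet
  obtain ⟨c, hc0, hc⟩ := Matrix.exists_vecMul_eq_zero_iff.2 hdet
  have hli := T.linearIndependent_projection_h_pow hp
  set C := LinearMap.ker (LieAlgebra.ad K g ⟨h, T.h_mem⟩) with hC
  have hmem : ∀ m : ℕ, p (h ^ m) ∈ C := by
    intro m
    rw [hC, LinearMap.mem_ker, LieAlgebra.ad_apply,
      ← LieSubalgebra.projection_lie hp ⟨h, T.h_mem⟩, lie_self_pow, map_zero]
  have hspan : Submodule.span K (Set.range fun r : powExponents g x d => p (h ^ (r : ℕ))) = C := by
    refine Submodule.eq_of_le_of_finrank_le ?_ ?_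
    · rw [Submodule.span_le]
      rintro _ ⟨r, rfl⟩
      exact hmem r
    · rw [finrank_span_eq_card hli, Fintype.card_coe]
      exact T.finrank_ker_ad_le hd hsl
  let z : g := ∑ r, c r • p (h ^ (r : ℕ))
  have hzC : z ∈ C := Submodule.sum_mem _ fun r _ => C.smul_mem _ (hmem r)
  have h1 : ∀ s : powExponents g x d,
      LinearMap.trace K V ((p (h ^ (s : ℕ)) : Module.End K V) * z) = 0 := by
    intro s
    have h2 := congrFun hc s
    rw [hp, LinearMap.trace_mul_comm]
    have h3 : ((z : g) : Module.End K V) = ∑ r, c r • (p (h ^ (r : ℕ)) : Module.End K V) := by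
      simp [z]
    rw [h3, Finset.sum_mul, map_sum]
    simpa [Matrix.vecMul, dotProduct] using h2
  have h2 : ∀ w ∈ C, LinearMap.trace K V ((w : Module.End K V) * z) = 0 := by
    intro w hw
    rw [← hspan] at hw
    induction hw using Submodule.span_induction with
    | mem w hw =>
      obtain ⟨s, rfl⟩ := hw
      exact h1 s
    | zero => simp
    | add a b _ _ ha hb => simp [add_mul, ha, hb]
    | smul k a _ ha => simp [ha]
  have hz0 : (z : Module.End K V) = 0 := by
    refine T.eq_zero_of_trace_mul_h_pow (congrArg Subtype.val (LinearMap.mem_ker.1 hzC)) ?_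
    intro m
    rw [LinearMap.trace_mul_comm, ← hp]
    exact h2 _ (hmem m)
  have hz0' : z = 0 := Subtype.ext hz0
  exact hc0 (funext (Fintype.linearIndependent_iff.1 hli c hz0'))

/-- In any Cartan subalgebra there is an element `c` such that the projections of the powers
`c ^ r`, for `r` in `powExponents g x d`, form a basis of the Cartan subalgebra. -/
theorem exists_linearIndependent_projection_pow [IsAlgClosed K] [FiniteDimensional K V]
    [LieAlgebra.IsSemisimple K g]
    (hd : d ≠ 0) (hsl : ∀ a ∈ g, LinearMap.trace K V a = 0)
    {p : Module.End K V →ₗ[K] g}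
    (hp : ∀ a (w : g),
      LinearMap.trace K V ((p a : Module.End K V) * w) = LinearMap.trace K V (a * w))
    (H : LieSubalgebra K g) [H.IsCartanSubalgebra] :
    (powExponents g x d).card = finrank K H ∧
    ∃ c : H, (∀ m : ℕ, p (((c : g) : Module.End K V) ^ m) ∈ H) ∧
      LinearIndependent K
        fun r : powExponents g x d => p (((c : g) : Module.End K V) ^ (r : ℕ)) := by
  have hle : finrank K H ≤ (powExponents g x d).card :=
    ((LieAlgebra.IsKilling.finrank_cartan_le_finrank_maxGenEigenspace H ⟨h, T.h_mem⟩).trans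
      (Submodule.finrank_mono T.maxGenEigenspace_ad_le_ker)).trans (T.finrank_ker_ad_le hd hsl)
  obtain ⟨c, hc⟩ := LieSubalgebra.exists_gram_det_ne_zero H hp
    (fun r : powExponents g x d => (r : ℕ)) ⟨h, T.h_mem⟩ (T.gram_det_ne_zero hd hsl hp)
  have hli : LinearIndependent K
      fun r : powExponents g x d => p (((c : g) : Module.End K V) ^ (r : ℕ)) := by
    rw [Fintype.linearIndependent_iff]
    intro k hk
    by_contra hne
    rw [not_forall] at hne
    apply hc
    refine Matrix.exists_vecMul_eq_zero_iff.1 ⟨k, fun h => ?_, ?_⟩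
    · obtain ⟨i, hi⟩ := hne
      exact hi (congrFun h i)
    · ext s
      have h1 := congrArg (fun w : g => LinearMap.trace K V
        ((w : Module.End K V) * ((c : g) : Module.End K V) ^ (s : ℕ))) hk
      have h3 : ((∑ r, k r • p (((c : g) : Module.End K V) ^ ((r : powExponents g x d) : ℕ)) : g) :
          Module.End K V) =
          ∑ r, k r • (p (((c : g) : Module.End K V) ^ ((r : powExponents g x d) : ℕ)) :
            Module.End K V) := by
        simp
      simp only [h3, Finset.sum_mul, map_sum] at h1
      simpa [Matrix.vecMul, dotProduct] using h1
  -- `H` is abelian, so it commutes with `c ^ m` and, by equivariance, with its projection; a Cartan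
  -- subalgebra is its own normalizer.
  have hmem : ∀ m : ℕ, p (((c : g) : Module.End K V) ^ m) ∈ H := by
    intro m
    have hn : p (((c : g) : Module.End K V) ^ m) ∈ H.normalizer := by
      rw [LieSubalgebra.mem_normalizer_iff']
      intro b hb
      have h1 : ⁅(⟨b, hb⟩ : H), c⁆ = 0 := trivial_lie_zero _ _ _ _
      have h2 : ⁅(b : Module.End K V), ((c : g) : Module.End K V)⁆ = 0 :=
        congrArg (fun z : H => ((z : g) : Module.End K V)) h1
      have h3 : ⁅(b : Module.End K V), ((c : g) : Module.End K V) ^ m⁆ = 0 := by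
        rw [Ring.lie_def, sub_eq_zero] at *
        exact ((show Commute _ _ from h2).pow_right m).eq
      have h4 := LieSubalgebra.projection_lie hp b (((c : g) : Module.End K V) ^ m)
      rw [h3, map_zero] at h4
      rw [← h4]
      exact H.zero_mem
    rwa [LieSubalgebra.IsCartanSubalgebra.self_normalizing] at hn
  refine ⟨le_antisymm ?_ hle, c, hmem, hli⟩
  have hli' : LinearIndependent K (fun r : powExponents g x d =>
      (⟨p (((c : g) : Module.End K V) ^ (r : ℕ)), hmem r⟩ : H)) :=
    LinearIndependent.of_comp H.toSubmodule.subtype hli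
  simpa using hli'.fintype_card_le_finrank

end IsCyclicSl2

/-! ### Invariance of power traces under reflections -/

section TraceInvariance

open TensorProduct

variable {K A : Type*} [Field K] [CharZero K] [Ring A] [Algebra K A]

/-- A trace form takes the same value on the powers of `z` and of `exp (ad e) z`, if
`(ad e) ^ 3` kills `z`. -/
theorem apply_pow_eq_of_commutator (τ : A →ₗ[K] K) (hτ : ∀ a b, τ (a * b) = τ (b * a))
    {e z w₁ w₂ : A} (h₁ : e * z - z * e = w₁) (h₂ : e * w₁ - w₁ * e = (2 : K) • w₂)
    (h₃ : e * w₂ - w₂ * e = 0) (m : ℕ) : τ ((z + w₁ + w₂) ^ m) = τ (z ^ m) := by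
  -- `Z` is `exp (t ad e) z` as a polynomial in `t`. It satisfies `Z' = ⁅e, Z⁆`, so the trace of `Z
  -- ^ m` is constant; compare `t = 0` and `t = 1`.
  let Z : Polynomial K ⊗[K] A :=
    1 ⊗ₜ z + Polynomial.X ⊗ₜ w₁ + (Polynomial.X ^ 2 : Polynomial K) ⊗ₜ w₂
  let D : Derivation K (Polynomial K) (Polynomial K) := Polynomial.derivative'
  have hD : ∀ P, D P = Polynomial.derivative P := fun P => rfl
  have hDZ : D.tensor A Z = (1 ⊗ₜ e) * Z - Z * (1 ⊗ₜ e) := by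
    have h : (1 ⊗ₜ e) * Z - Z * (1 ⊗ₜ e) = 1 ⊗ₜ (e * z - z * e) +
        Polynomial.X ⊗ₜ (e * w₁ - w₁ * e) +
        (Polynomial.X ^ 2 : Polynomial K) ⊗ₜ (e * w₂ - w₂ * e) := by
      simp only [Z, mul_add, add_mul, Algebra.TensorProduct.tmul_mul_tmul, one_mul, mul_one,
        TensorProduct.tmul_sub]
      abel
    rw [h, h₁, h₂, h₃]
    simp only [Z, map_add, Derivation.tensor_tmul, hD, Polynomial.derivative_one,
      Polynomial.derivative_X, Polynomial.derivative_X_pow, TensorProduct.zero_tmul,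
      TensorProduct.tmul_zero, TensorProduct.tmul_smul, zero_add,
      add_zero]
    rw [TensorProduct.smul_tmul']
    congr 2
    simp [Polynomial.smul_eq_C_mul]
  have hconst : Polynomial.derivative (tensorTrace (Polynomial K) τ (Z ^ m)) = 0 := by
    rw [← hD, D.tensorTrace, D.tensor_pow_of_commutator hDZ, map_sub,
      tensorTrace_mul_comm τ hτ, sub_self]
  have hev : ∀ t : K, (tensorTrace (Polynomial K) τ (Z ^ m)).eval t =
      τ ((z + t • w₁ + t ^ 2 • w₂) ^ m) := by
    intro t
    rw [← Polynomial.coe_aeval_eq_eval, algHom_tensorTrace, map_pow (tensorEval _ _)]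
    simp [Z]
  have h₀ := hev 0
  have h₁ := hev 1
  rw [Polynomial.eq_C_of_derivative_eq_zero hconst, Polynomial.eval_C] at h₀ h₁
  rw [h₀] at h₁
  simpa using h₁.symm

/-- Powers of `a₀ + c • h` and `a₀ - c • h` have the same trace, for an `𝔰𝔩₂`-triple `h, e, f`
commuting with `a₀`. -/
theorem apply_pow_eq_of_sl2 (τ : A →ₗ[K] K) (hτ : ∀ a b, τ (a * b) = τ (b * a))
    {h e f a₀ : A} (hhe : h * e - e * h = (2 : K) • e) (hhf : h * f - f * h = -((2 : K) • f))
    (hef : e * f - f * e = h) (he : a₀ * e - e * a₀ = 0) (hf : a₀ * f - f * a₀ = 0) (c : K)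
    (m : ℕ) : τ ((a₀ + c • h) ^ m) = τ ((a₀ - c • h) ^ m) := by
  -- The reflection is realized by applying `exp (ad e)`, then `exp (-ad f)`, then `exp (ad e)`: the
  -- successive values are `a₀ + c h`, `a₀ + c h - 2c e`, `a₀ - c h - 2c e` and `a₀ - c h`.
  have e₁ : e * (a₀ + c • h) - (a₀ + c • h) * e = -((2 * c) • e) := by
    have : e * (a₀ + c • h) - (a₀ + c • h) * e =
        -(a₀ * e - e * a₀) - c • (h * e - e * h) := by
      simp only [mul_add, add_mul, mul_smul_comm, smul_mul_assoc, smul_sub]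
      module
    rw [this, he, hhe]
    module
  have s₁ := apply_pow_eq_of_commutator τ hτ (w₂ := 0) e₁ (by simp) (by simp) m
  have e₂ : (-f) * (a₀ + c • h + -((2 * c) • e) + 0) - (a₀ + c • h + -((2 * c) • e) + 0) * (-f) =
      -((2 * c) • f) - (2 * c) • h := by
    have : (-f) * (a₀ + c • h + -((2 * c) • e) + 0) -
        (a₀ + c • h + -((2 * c) • e) + 0) * (-f) =
        (a₀ * f - f * a₀) + c • (h * f - f * h) - (2 * c) • (e * f - f * e) := by
      simp only [mul_add, add_mul, mul_smul_comm, smul_mul_assoc, smul_sub, mul_neg, neg_mul,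
        mul_zero, zero_mul]
      module
    rw [this, hf, hhf, hef]
    module
  have e₃ : (-f) * (-((2 * c) • f) - (2 * c) • h) - (-((2 * c) • f) - (2 * c) • h) * (-f) =
      (2 : K) • ((2 * c) • f) := by
    have : (-f) * (-((2 * c) • f) - (2 * c) • h) - (-((2 * c) • f) - (2 * c) • h) * (-f) =
        -((2 * c) • (h * f - f * h)) := by
      simp only [mul_sub, sub_mul, mul_smul_comm, smul_mul_assoc, smul_sub, mul_neg, neg_mul]
      module
    rw [this, hhf]
    module
  have s₂ := apply_pow_eq_of_commutator τ hτ e₂ e₃ (by simp) m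
  have e₄ : a₀ + c • h + -((2 * c) • e) + 0 + (-((2 * c) • f) - (2 * c) • h) + (2 * c) • f =
      a₀ - c • h + -((2 * c) • e) := by
    module
  rw [e₄] at s₂
  have e₅ : e * (a₀ - c • h + -((2 * c) • e)) - (a₀ - c • h + -((2 * c) • e)) * e =
      (2 * c) • e := by
    have : e * (a₀ - c • h + -((2 * c) • e)) - (a₀ - c • h + -((2 * c) • e)) * e =
        -(a₀ * e - e * a₀) + c • (h * e - e * h) := by
      simp only [mul_add, add_mul, mul_sub, sub_mul, mul_smul_comm, smul_mul_assoc, smul_sub,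
        mul_neg, neg_mul]
      module
    rw [this, he, hhe]
    module
  have s₃ := apply_pow_eq_of_commutator τ hτ (w₂ := 0) e₅ (by simp) (by simp) m
  rw [add_zero, neg_add_cancel_right] at s₃
  rw [← s₁, ← s₂, s₃]

end TraceInvariance

namespace LieSubalgebra

open LieAlgebra LieAlgebra.IsKilling

variable {K V : Type*} [Field K] [CharZero K] [IsAlgClosed K] [AddCommGroup V] [Module K V]
  [FiniteDimensional K V] {g : LieSubalgebra K (Module.End K V)} [LieAlgebra.IsSemisimple K g]

/-- Traces of powers of elements of a Cartan subalgebra are invariant under reflections. -/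
theorem trace_pow_sub_smul_coroot (H : LieSubalgebra K g) [H.IsCartanSubalgebra]
    {α : LieModule.Weight K H g} (hα : α.IsNonZero) (a : H) (m : ℕ) :
    LinearMap.trace K V ((((a - α a • coroot α : H) : g) : Module.End K V) ^ m) =
      LinearMap.trace K V (((a : g) : Module.End K V) ^ m) := by
  obtain ⟨h, e, f, ht, he, hf⟩ := exists_isSl2Triple_of_weight_isNonZero hα
  have hh : h = coroot α := ht.h_eq_coroot hα he hf
  -- The component of `a` on the mirror of `α`; it commutes with both root vectors.
  let a₀ : H := a - (α a / 2) • coroot α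
  have hα₀ : α a₀ = 0 := by
    have h2 : (α : LieModule.Weight K H g) (coroot α) = 2 := root_apply_coroot hα
    have h3 : α a₀ = LieModule.Weight.toLinear K H g α a₀ := rfl
    rw [h3, map_sub, map_smul]
    change α a - (α a / 2) • α (coroot α) = 0
    rw [h2, smul_eq_mul, div_mul_cancel₀ _ two_ne_zero, sub_self]
  have h1 : ⁅(a₀ : g), e⁆ = 0 := by
    have := lie_eq_smul_of_mem_rootSpace he a₀
    rw [hα₀, zero_smul] at this
    exact this
  have h2 : ⁅(a₀ : g), f⁆ = 0 := by
    have := lie_eq_smul_of_mem_rootSpace hf a₀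
    rw [Pi.neg_apply, hα₀, neg_zero, zero_smul] at this
    exact this
  have key := apply_pow_eq_of_sl2 (LinearMap.trace K V) (fun x y => LinearMap.trace_mul_comm K x y)
    (h := (h : Module.End K V)) (e := (e : Module.End K V)) (f := (f : Module.End K V))
    (a₀ := ((a₀ : g) : Module.End K V)) (congrArg Subtype.val (ht.lie_h_e_smul K))
    (congrArg Subtype.val (ht.lie_lie_smul_f K)) (congrArg Subtype.val ht.lie_e_f)
    (congrArg Subtype.val h1) (congrArg Subtype.val h2) (α a / 2) m
  have hc : (h : Module.End K V) = (((coroot α : H) : g) : Module.End K V) := by rw [hh]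
  rw [hc] at key
  have k1 : ((a₀ : g) : Module.End K V) + (α a / 2) • (((coroot α : H) : g) : Module.End K V) =
      ((a : g) : Module.End K V) := by
    simp [a₀]
  have k2 : ((a₀ : g) : Module.End K V) - (α a / 2) • (((coroot α : H) : g) : Module.End K V) =
      (((a - α a • coroot α : H) : g) : Module.End K V) := by
    have k3 : ((a₀ : g) : Module.End K V) = ((a : g) : Module.End K V) -
        (α a / 2) • (((coroot α : H) : g) : Module.End K V) := rfl
    have k4 : (((a - α a • coroot α : H) : g) : Module.End K V) = ((a : g) : Module.End K V) -
        α a • (((coroot α : H) : g) : Module.End K V) := rfl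
    rw [k3, k4]
    module
  rw [k1, k2] at key
  exact key.symm

end LieSubalgebra

/-! ### Jacobians of homogeneous polynomials -/

namespace MvPolynomial

variable {K ι : Type*} [Field K] [Fintype ι]

theorem pderiv_aeval (G : ι → MvPolynomial ι K) (P : MvPolynomial ι K) (j : ι) :
    pderiv j (aeval G P) = ∑ i, aeval G (pderiv i P) * pderiv j (G i) := by
  classical
  induction P using MvPolynomial.induction_on with
  | C a => simp
  | add p q hp hq => simp only [map_add, hp, hq, add_mul, Finset.sum_add_distrib]
  | mul_X p k hp =>
    rw [map_mul, Derivation.leibniz, hp, aeval_X]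
    simp only [Derivation.leibniz, pderiv_X, smul_eq_mul, map_add, map_mul, aeval_X, add_mul,
      Finset.sum_add_distrib]
    congr 1
    · rw [Finset.sum_eq_single k]
      · simp
      · intro i _ hi
        simp [hi.symm]
      · simp
    · rw [Finset.mul_sum]
      exact Finset.sum_congr rfl fun i _ => by ring

theorem isHomogeneous_aeval_monomial {G : ι → MvPolynomial ι K} {d : ι → ℕ}
    (hG : ∀ i, (G i).IsHomogeneous (d i)) (m : ι →₀ ℕ) (c : K) :
    (aeval G (monomial m c)).IsHomogeneous (∑ i, d i * m i) := by
  rw [aeval_monomial, MvPolynomial.algebraMap_eq, Finsupp.prod_fintype _ _ (by simp)]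
  have := (isHomogeneous_C ι c).mul
    (IsHomogeneous.prod Finset.univ (fun i => G i ^ m i) (fun i => d i * m i)
      fun i _ => (hG i).pow (m i))
  simpa using this

/-- A homogeneous polynomial of degree `e` in homogeneous elements `G i` of degrees `d i` can be
written without the `G i` with `e < d i`. -/
theorem exists_eq_aeval_of_isHomogeneous {G : ι → MvPolynomial ι K} {d : ι → ℕ}
    (hG : ∀ i, (G i).IsHomogeneous (d i)) {F : MvPolynomial ι K} {e : ℕ} (hF : F.IsHomogeneous e)
    (hFG : F ∈ Algebra.adjoin K (Set.range G)) :
    ∃ P : MvPolynomial ι K, F = aeval G P ∧ ∀ i, pderiv i P ≠ 0 → d i ≤ e := by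
  classical
  rw [Algebra.adjoin_range_eq_range_aeval] at hFG
  obtain ⟨Q, rfl⟩ := hFG
  -- Only the monomials of weighted degree `e` contribute to the component of degree `e`, and a
  -- variable of weight above `e` cannot occur in them.
  refine ⟨∑ m ∈ Q.support.filter (fun m => ∑ i, d i * m i = e), monomial m (coeff m Q), ?_, ?_⟩
  · change aeval G Q = _
    have h1 : aeval G Q = ∑ m ∈ Q.support, aeval G (monomial m (coeff m Q)) := by
      conv_lhs => rw [Q.as_sum, map_sum]
    have h2 := homogeneousComponent_of_mem (m := e) (n := e) hF
    rw [if_pos rfl] at h2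
    change homogeneousComponent e (aeval G Q) = aeval G Q at h2
    rw [← h2, h1, map_sum, map_sum, Finset.sum_filter]
    refine Finset.sum_congr rfl fun m _ => ?_
    rw [homogeneousComponent_of_mem (isHomogeneous_aeval_monomial hG m _)]
    by_cases h : ∑ i, d i * m i = e
    · rw [if_pos h, if_pos h.symm]
    · rw [if_neg h, if_neg (Ne.symm h)]
  · intro i hi
    rw [map_sum] at hi
    obtain ⟨m, hm, hne⟩ := Finset.exists_ne_zero_of_sum_ne_zero hi
    rw [pderiv_monomial] at hne
    have hmi : m i ≠ 0 := by
      intro h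
      exact hne (by simp [h])
    rw [← (Finset.mem_filter.1 hm).2]
    calc d i ≤ d i * m i := Nat.le_mul_of_pos_right _ (Nat.pos_of_ne_zero hmi)
      _ ≤ ∑ i, d i * m i :=
        Finset.single_le_sum (f := fun i => d i * m i) (fun _ _ => Nat.zero_le _)
          (Finset.mem_univ i)

variable [DecidableEq ι]

/-- If homogeneous elements `F s` of the algebra generated by homogeneous `G i` have nonzero
Jacobian, then so have the `G i`, and up to a permutation their degrees are at most those of the
`F s`. -/
theorem exists_perm_le_of_jacobian_ne_zero {G F : ι → MvPolynomial ι K} {d e : ι → ℕ}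
    (hG : ∀ i, (G i).IsHomogeneous (d i)) (hF : ∀ s, (F s).IsHomogeneous (e s))
    (hFG : ∀ s, F s ∈ Algebra.adjoin K (Set.range G))
    (hJ : (Matrix.of fun s j => pderiv j (F s)).det ≠ 0) :
    (Matrix.of fun i j => pderiv j (G i)).det ≠ 0 ∧
      ∃ σ : Equiv.Perm ι, ∀ s, d (σ s) ≤ e s := by
  choose P hP hPd using fun s => exists_eq_aeval_of_isHomogeneous hG (hF s) (hFG s)
  have hmul : (Matrix.of fun s j => pderiv j (F s)) =
      (Matrix.of fun s i => aeval G (pderiv i (P s))) * Matrix.of fun i j => pderiv j (G i) := by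
    ext1 s j
    rw [Matrix.mul_apply, Matrix.of_apply, hP s, pderiv_aeval]
    rfl
  rw [hmul, Matrix.det_mul] at hJ
  refine ⟨right_ne_zero_of_mul hJ, ?_⟩
  have h1 := left_ne_zero_of_mul hJ
  rw [← Matrix.det_transpose, Matrix.det_apply] at h1
  -- By the chain rule the matrix of partial derivatives of the `P s` has nonzero determinant, so
  -- some term of its expansion is nonzero: `F s` really involves `G (σ s)` for every `s`, which
  -- bounds the degrees.
  obtain ⟨σ, -, hσ⟩ := Finset.exists_ne_zero_of_sum_ne_zero h1
  refine ⟨σ, fun s => hPd s _ fun h => hσ ?_⟩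
  rw [Finset.prod_eq_zero (Finset.mem_univ s), smul_zero]
  rw [Matrix.transpose_apply, Matrix.of_apply, h, map_zero]

theorem isHomogeneous_jacobian {G : ι → MvPolynomial ι K} {d : ι → ℕ}
    (hG : ∀ i, (G i).IsHomogeneous (d i)) :
    (Matrix.of fun i j => pderiv j (G i)).det.IsHomogeneous (∑ i, (d i - 1)) := by
  rw [← Matrix.det_transpose, Matrix.det_apply]
  refine IsHomogeneous.sum _ _ _ fun σ _ => ?_
  have h := IsHomogeneous.prod Finset.univ (fun i => pderiv (σ i) (G i)) (fun i => d i - 1)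
    fun i _ => (hG i).pderiv
  rcases Int.units_eq_one_or (Equiv.Perm.sign σ) with hs | hs
  · rw [hs, one_smul]
    exact h
  · rw [hs]
    simpa using h.neg

end MvPolynomial

/-! ### Counting mirrors by the degree of the Jacobian -/

section Reflections

open MvPolynomial Module

variable {K L ι : Type*} [Field K] [CharZero K] [AddCommGroup L] [Module K L] [Fintype ι]

/-- The restriction of a polynomial function to the line through `a` in the direction of `c`. -/
noncomputable def MvPolynomial.restrictLine (b : Basis ι K L) (a c : L) :
    MvPolynomial ι K →ₐ[K] Polynomial K :=
  aeval fun i => Polynomial.C (b.repr a i) + Polynomial.C (b.repr c i) * Polynomial.X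

omit [CharZero K] [Fintype ι] in
theorem MvPolynomial.eval_restrictLine (b : Basis ι K L) (a c : L) (P : MvPolynomial ι K) (t : K) :
    (restrictLine b a c P).eval t = eval (b.repr (a + t • c)) P := by
  rw [← Polynomial.coe_evalRingHom, restrictLine, aeval_def, MvPolynomial.hom_eval₂,
    ← eval₂_id (p := P)]
  congr 1
  · ext r; simp
  · ext i
    simp only [Polynomial.coe_evalRingHom, Polynomial.eval_mul, Polynomial.eval_C,
      Polynomial.eval_X, map_add, map_smul, Finsupp.add_apply,
      Finsupp.smul_apply, smul_eq_mul]
    ring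

omit [CharZero K] in
theorem MvPolynomial.natDegree_restrictLine_le (b : Basis ι K L) (a c : L) {P : MvPolynomial ι K}
    {N : ℕ} (hP : P.IsHomogeneous N) : (restrictLine b a c P).natDegree ≤ N := by
  rw [P.as_sum, map_sum]
  refine Polynomial.natDegree_sum_le_of_forall_le _ _ fun m hm => ?_
  have h1 : ∑ i, m i = N := by
    have := hP (mem_support_iff.1 hm)
    rw [Finsupp.weight_apply] at this
    simpa [Finsupp.sum_fintype] using this
  rw [restrictLine, aeval_monomial, Finsupp.prod_fintype _ _ (by simp), ← h1]
  refine (Polynomial.natDegree_C_mul_le _ _).trans ((Polynomial.natDegree_prod_le _ _).trans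
    (Finset.sum_le_sum fun i _ => ?_))
  rw [add_comm]
  exact Polynomial.natDegree_pow_le.trans
    ((Nat.mul_le_mul_left _ Polynomial.natDegree_linear_le).trans (mul_one _).le)

/-- The gradient of a reflection invariant function is tangent to the mirror. -/
theorem sum_eval_pderiv_mul_eq_zero (b : Basis ι K L) (α : Dual K L) (c : L) (hc : α c = 2)
    (P : MvPolynomial ι K)
    (hP : ∀ w, eval (b.repr (w - α w • c)) P = eval (b.repr w) P) {w : L} (hw : α w = 0) :
    ∑ i, eval (b.repr w) (pderiv i P) * b.repr c i = 0 := by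
  let q := restrictLine b w c P
  -- Along the line through a point of the mirror in the direction `c`, the reflection is `t ↦ -t`;
  -- an even polynomial has zero derivative at `0`.
  have h1 : q.comp (-Polynomial.X) = q := by
    refine Polynomial.funext fun t => ?_
    have h2 : w + t • c - α (w + t • c) • c = w + -t • c := by
      rw [map_add, hw, map_smul, hc, smul_eq_mul]
      module
    rw [Polynomial.eval_comp, Polynomial.eval_neg, Polynomial.eval_X, eval_restrictLine,
      eval_restrictLine, ← hP (w + t • c), h2]
  have h2 : (Polynomial.derivative q).eval 0 = 0 := by
    have h3 := congrArg (fun r => (Polynomial.derivative r).eval 0) h1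
    simp only [Polynomial.derivative_comp, Polynomial.eval_mul, Polynomial.eval_comp,
      Polynomial.derivative_neg, Polynomial.derivative_X, Polynomial.eval_neg, Polynomial.eval_X,
      Polynomial.eval_one, neg_zero] at h3
    have h4 : (2 : K) * (Polynomial.derivative q).eval 0 = 0 := by linear_combination -h3
    exact (mul_eq_zero.1 h4).resolve_left two_ne_zero
  have h3 : Polynomial.derivative q =
      ∑ i, restrictLine b w c (pderiv i P) * Polynomial.C (b.repr c i) := by
    simp only [q, restrictLine]
    rw [derivative_aeval]
    simp
  rw [h3, Polynomial.eval_finsetSum] at h2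
  simpa [eval_restrictLine] using h2

variable [DecidableEq ι]

/-- The number of mirrors of a reflection group is bounded by the degree of the Jacobian of its
invariants. -/
theorem card_le_two_mul_sum_of_reflection_invariant (b : Basis ι K L) (Φ : Finset (Dual K L))
    (co : Dual K L → L) (hco : ∀ α ∈ Φ, α (co α) = 2)
    (hΦ : ∀ α ∈ Φ, ∀ β ∈ Φ, ∀ t : K, β = t • α → β = α ∨ β = -α)
    {G : ι → MvPolynomial ι K} {d : ι → ℕ} (hG : ∀ i, (G i).IsHomogeneous (d i))
    (hinv : ∀ i, ∀ α ∈ Φ, ∀ w, eval (b.repr (w - α w • co α)) (G i) = eval (b.repr w) (G i))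
    (hJ : (Matrix.of fun i j => pderiv j (G i)).det ≠ 0) :
    Φ.card ≤ 2 * ∑ i, (d i - 1) := by
  classical
  set J := (Matrix.of fun i j => pderiv j (G i)).det with hJdef
  -- On the mirror every gradient annihilates the nonzero vector `co α`, so the Jacobian matrix is
  -- singular there.
  have hmirror : ∀ α ∈ Φ, ∀ w, α w = 0 → eval (b.repr w) J = 0 := by
    intro α hα w hw
    rw [hJdef, RingHom.map_det]
    refine Matrix.exists_mulVec_eq_zero_iff.1 ⟨b.repr (co α), fun h => ?_, ?_⟩
    · have h0 : co α = 0 := b.repr.map_eq_zero_iff.1 (DFunLike.coe_injective h)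
      have := hco α hα
      rw [h0, map_zero] at this
      exact two_ne_zero this.symm
    · ext i
      exact sum_eval_pderiv_mul_eq_zero b α (co α) (hco α hα) (G i) (hinv i α hα) hw
  obtain ⟨a, ha⟩ : ∃ a : L, eval (b.repr a) J ≠ 0 := by
    by_contra! h
    refine hJ (MvPolynomial.funext fun z => ?_)
    rw [map_zero, ← h (b.equivFun.symm z)]
    congr 2
    ext i
    rw [← b.equivFun_apply, LinearEquiv.apply_symm_apply]
  have haΦ : ∀ α ∈ Φ, α a ≠ 0 := fun α hα h => ha (hmirror α hα a h)
  -- A generic direction `c`: the line `a + t c` crosses every mirror, and crosses mirrors of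
  -- non-opposite distinct elements at different `t`. Thus each root of `J` on the line accounts for
  -- at most the two elements `α` and `-α`.
  obtain ⟨c, hc⟩ := Module.Dual.exists_forall_ne_zero_of_forall_exists
    (f := fun x : Φ × Φ => if (x.2 : Dual K L) = x.1 ∨ (x.2 : Dual K L) = -x.1 then
      (x.1 : Dual K L) else (x.1 : Dual K L) a • (x.2 : Dual K L) - (x.2 : Dual K L) a •
        (x.1 : Dual K L)) (by
      rintro ⟨⟨α, hα⟩, ⟨β, hβ⟩⟩
      simp only
      split_ifs with h
      · exact ⟨a, haΦ α hα⟩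
      · by_contra! h1
        refine h (hΦ α hα β hβ (β a / α a) (LinearMap.ext fun z => ?_))
        have h2 := h1 z
        simp only [LinearMap.sub_apply, LinearMap.smul_apply, smul_eq_mul] at h2 ⊢
        have := haΦ α hα
        field_simp
        linear_combination h2)
  have hc1 : ∀ α ∈ Φ, α c ≠ 0 := fun α hα => by
    have := hc (⟨α, hα⟩, ⟨α, hα⟩)
    simpa using this
  have hc2 : ∀ α ∈ Φ, ∀ β ∈ Φ, α a * β c - β a * α c = 0 → β = α ∨ β = -α := by
    intro α hα β hβ h
    by_contra hne
    have := hc (⟨α, hα⟩, ⟨β, hβ⟩)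
    simp only [if_neg hne] at this
    exact this (by simpa using h)
  let q := restrictLine b a c J
  have hq : q ≠ 0 := by
    intro h
    apply ha
    have := eval_restrictLine b a c J 0
    rw [zero_smul, add_zero] at this
    rw [← this]
    change q.eval 0 = 0
    rw [h, Polynomial.eval_zero]
  have himg : Φ.image (fun α => -(α a) / α c) ⊆ q.roots.toFinset := by
    intro t ht
    obtain ⟨α, hα, rfl⟩ := Finset.mem_image.1 ht
    rw [Multiset.mem_toFinset, Polynomial.mem_roots hq, Polynomial.IsRoot, eval_restrictLine]
    apply hmirror α hα
    rw [map_add, map_smul, smul_eq_mul, div_mul_cancel₀ _ (hc1 α hα), add_neg_cancel]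
  have hfib : ∀ t ∈ Φ.image (fun α => -(α a) / α c),
      (Φ.filter fun α => -(α a) / α c = t).card ≤ 2 := by
    intro t ht
    obtain ⟨α, hα, rfl⟩ := Finset.mem_image.1 ht
    refine (Finset.card_le_card (t := {α, -α}) fun β hβ => ?_).trans Finset.card_le_two
    obtain ⟨hβ, h⟩ := Finset.mem_filter.1 hβ
    rw [Finset.mem_insert, Finset.mem_singleton]
    apply hc2 α hα β hβ
    rw [div_eq_div_iff (hc1 β hβ) (hc1 α hα)] at h
    linear_combination h
  calc Φ.card ≤ 2 * (Φ.image (fun α => -(α a) / α c)).card :=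
        Finset.card_le_mul_card_image _ 2 hfib
    _ ≤ 2 * ∑ i, (d i - 1) := by
        refine Nat.mul_le_mul_left 2 ((Finset.card_le_card himg).trans
          ((Multiset.toFinset_card_le _).trans ((Polynomial.card_roots' q).trans
            (natDegree_restrictLine_le b a c (isHomogeneous_jacobian hG)))))

end Reflections

/-! ### Weyl invariants as polynomial functions on `H`, and the number of roots -/

namespace RootPairing

variable {ι K M N : Type*} [Field K] [AddCommGroup M] [Module K M] [AddCommGroup N] [Module K N]

theorem mem_weylInvariants_iff (P : RootPairing ι K M N) (F : SymmetricAlgebra K M) :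
    F ∈ P.weylInvariants ↔ ∀ i, SymmetricAlgebra.lift
      (SymmetricAlgebra.ι K M ∘ₗ (P.reflection i : M →ₗ[K] M)) F = F := by
  have hmem : F ∈ P.weylInvariants ↔ ∀ w : P.weylGroup, SymmetricAlgebra.lift
      (SymmetricAlgebra.ι K M ∘ₗ P.weylGroupRootRep w) F = F := by
    rw [weylInvariants, Algebra.mem_iInf]
    rfl
  rw [hmem]
  constructor
  · intro h i
    exact h ⟨_, P.reflection_mem_weylGroup i⟩
  · rintro h ⟨w, hw⟩
    induction hw using weylGroup.induction with
    | mem i => exact h i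
    | one =>
      have : P.weylGroupRootRep ⟨1, one_mem _⟩ = LinearMap.id :=
        LinearMap.ext fun m => one_smul P.weylGroup m
      rw [this, LinearMap.comp_id, SymmetricAlgebra.lift_ι, AlgHom.id_apply]
    | mul w₁ w₂ h₁ h₂ ih₁ ih₂ =>
      have h3 : ∀ m, P.weylGroupRootRep ⟨w₁ * w₂, mul_mem h₁ h₂⟩ m =
          P.weylGroupRootRep ⟨w₁, h₁⟩ (P.weylGroupRootRep ⟨w₂, h₂⟩ m) := fun m =>
        mul_smul (⟨w₁, h₁⟩ : P.weylGroup) (⟨w₂, h₂⟩ : P.weylGroup) m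
      have h4 : SymmetricAlgebra.lift (SymmetricAlgebra.ι K M ∘ₗ
          P.weylGroupRootRep ⟨w₁ * w₂, mul_mem h₁ h₂⟩) =
          (SymmetricAlgebra.lift (SymmetricAlgebra.ι K M ∘ₗ P.weylGroupRootRep ⟨w₁, h₁⟩)).comp
          (SymmetricAlgebra.lift (SymmetricAlgebra.ι K M ∘ₗ P.weylGroupRootRep ⟨w₂, h₂⟩)) := by
        refine SymmetricAlgebra.algHom_ext (LinearMap.ext fun m => ?_)
        change SymmetricAlgebra.lift _ (SymmetricAlgebra.ι K M m) =
          SymmetricAlgebra.lift _ (SymmetricAlgebra.lift _ (SymmetricAlgebra.ι K M m))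
        simp only [SymmetricAlgebra.lift_ι_apply, LinearMap.comp_apply]
        exact congrArg (SymmetricAlgebra.ι K M) (h3 m)
      rw [h4, AlgHom.comp_apply, ih₂, ih₁]

end RootPairing

namespace SymmetricAlgebra

open Module

variable {K L κ : Type*} [Field K] [AddCommGroup L] [Module K L] [Finite κ] [DecidableEq κ]

theorem eval_equivMvPolynomial_dualBasis (b : Basis κ K L) (a : L)
    (F : SymmetricAlgebra K (Dual K L)) :
    MvPolynomial.eval (b.repr a) (equivMvPolynomial b.dualBasis F) = lift (Dual.eval K L a) F := by
  have h : (MvPolynomial.aeval (b.repr a) : MvPolynomial κ K →ₐ[K] K).comp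
      (equivMvPolynomial b.dualBasis).toAlgHom = lift (Dual.eval K L a) := by
    refine algHom_ext (b.dualBasis.ext fun i => ?_)
    change MvPolynomial.aeval (b.repr a) (equivMvPolynomial b.dualBasis (ι K _ (b.dualBasis i))) =
      lift (Dual.eval K L a) (ι K _ (b.dualBasis i))
    rw [equivMvPolynomial_ι_apply, lift_ι_apply, MvPolynomial.aeval_X, Dual.eval_apply,
      Basis.dualBasis_apply]
  rw [← MvPolynomial.aeval_eq_eval, ← h]
  rfl

omit [Finite κ] [DecidableEq κ] in
theorem isHomogeneous_equivMvPolynomial {M : Type*} [AddCommGroup M] [Module K M] [Finite κ]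
    (b : Basis κ K M) {m : ℕ}
    {F : SymmetricAlgebra K M} (hF : F ∈ LinearMap.range (SymmetricAlgebra.ι K M) ^ m) :
    (equivMvPolynomial b F).IsHomogeneous m := by
  have key : ∀ m : ℕ, LinearMap.range (SymmetricAlgebra.ι K M) ^ m ≤
      (MvPolynomial.homogeneousSubmodule κ K m).comap
        (equivMvPolynomial b).toAlgHom.toLinearMap := by
    intro m
    induction m with
    | zero =>
      rw [pow_zero, Submodule.one_le]
      change (equivMvPolynomial b 1).IsHomogeneous 0
      rw [map_one]
      exact MvPolynomial.isHomogeneous_one κ K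
    | succ m ih =>
      rw [pow_succ, Submodule.mul_le]
      rintro x hx _ ⟨w, rfl⟩
      have h1 : (equivMvPolynomial b (SymmetricAlgebra.ι K M w)).IsHomogeneous 1 := by
        cases nonempty_fintype κ
        rw [← b.sum_repr w]
        simp only [map_sum, map_smul, equivMvPolynomial_ι_apply]
        refine MvPolynomial.IsHomogeneous.sum _ _ _ fun i _ => ?_
        rw [MvPolynomial.smul_eq_C_mul]
        simpa using (MvPolynomial.isHomogeneous_C κ (b.repr w i)).mul
          (MvPolynomial.isHomogeneous_X K i)
      have h2 := MvPolynomial.IsHomogeneous.mul (ih hx) h1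
      simpa using h2
  exact key m hF

end SymmetricAlgebra

theorem Submodule.finrank_iSup_finset_le {K L κ : Type*} [Field K] [AddCommGroup L] [Module K L]
    [FiniteDimensional K L] (s : Finset κ) (S : κ → Submodule K L) :
    Module.finrank K (⨆ i ∈ s, S i : Submodule K L) ≤ ∑ i ∈ s, Module.finrank K (S i) := by
  classical
  induction s using Finset.induction_on with
  | empty => simp
  | insert a s ha ih =>
    rw [Finset.iSup_insert, Finset.sum_insert ha]
    exact (Submodule.finrank_add_le_finrank_add_finrank _ _).trans (Nat.add_le_add_left ih _)

namespace LieAlgebra.IsKilling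

open Module

variable {K L : Type*} [Field K] [CharZero K] [IsAlgClosed K] [LieRing L] [LieAlgebra K L]
  [FiniteDimensional K L] [LieAlgebra.IsKilling K L]
  (H : LieSubalgebra K L) [H.IsCartanSubalgebra]

theorem finrank_le_finrank_cartan_add_card_root :
    finrank K L ≤ finrank K H + H.root.card := by
  have h1 := LieAlgebra.cartan_sup_iSup_rootSpace_eq_top (K := K) (L := L) (H := H)
  have h2 : (⊤ : Submodule K L) = H.toSubmodule ⊔
      ⨆ α ∈ H.root, (LieAlgebra.rootSpace H α).toSubmodule := by
    have h3 : (⊤ : Submodule K L) = ((H.toLieSubmodule ⊔ ⨆ α : LieModule.Weight K H L,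
        ⨆ (_ : α.IsNonZero), LieAlgebra.rootSpace H α : LieSubmodule K H L) : Submodule K L) := by
      rw [h1]; rfl
    rw [h3]
    simp only [LieSubmodule.sup_toSubmodule, LieSubmodule.iSup_toSubmodule]
    congr 1
    refine iSup_congr fun α => ?_
    exact iSup_congr_Prop (by simp) fun _ => rfl
  rw [← finrank_top K L, h2]
  refine (Submodule.finrank_add_le_finrank_add_finrank _ _).trans
    (Nat.add_le_add_left ((Submodule.finrank_iSup_finset_le _ _).trans ?_) _)
  rw [Finset.card_eq_sum_ones]
  refine Finset.sum_le_sum fun α hα => ?_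
  exact (finrank_rootSpace_eq_one α (by simpa using hα)).le

/-- Over an infinite field an element of `S(H*)` is determined by its values on `H`, and reflecting
a functional by `α` is dual to reflecting the point by the coroot. -/
theorem mem_weylInvariants_rootSystem_iff (F : SymmetricAlgebra K (Dual K H)) :
    F ∈ (rootSystem H).weylInvariants ↔ ∀ α : LieModule.Weight K H L, α.IsNonZero → ∀ a : H,
      SymmetricAlgebra.lift (Dual.eval K H (a - α a • coroot α)) F =
        SymmetricAlgebra.lift (Dual.eval K H a) F := by
  classical
  have key : ∀ (α : H.root) (a : H), SymmetricAlgebra.lift (Dual.eval K H a)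
      (SymmetricAlgebra.lift (SymmetricAlgebra.ι K (Dual K H) ∘ₗ
        ((rootSystem H).reflection α : Dual K H →ₗ[K] Dual K H)) F) =
      SymmetricAlgebra.lift
        (Dual.eval K H (a - (α : LieModule.Weight K H L) a • coroot α.1)) F := by
    intro α a
    rw [← AlgHom.comp_apply]
    congr 1
    refine SymmetricAlgebra.algHom_ext (LinearMap.ext fun m => ?_)
    simp [RootPairing.reflection_apply, mul_comm]
  rw [RootPairing.mem_weylInvariants_iff]
  constructor
  · intro h α hα a
    rw [← key ⟨α, by simpa using hα⟩ a, h]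
  · rintro h ⟨α, hα⟩
    let b := Module.finBasis K H
    apply (SymmetricAlgebra.equivMvPolynomial b.dualBasis).injective
    refine MvPolynomial.funext fun z => ?_
    have hz : z = b.repr (b.equivFun.symm z) := by
      ext i
      rw [← b.equivFun_apply, LinearEquiv.apply_symm_apply]
    rw [hz, SymmetricAlgebra.eval_equivMvPolynomial_dualBasis,
      SymmetricAlgebra.eval_equivMvPolynomial_dualBasis, key]
    exact h α (by simpa using hα) _

theorem card_root_le_two_mul_sum {ι : Type*} [Fintype ι] [DecidableEq ι] (b : Module.Basis ι K H)
    {G : ι → MvPolynomial ι K} {d : ι → ℕ} (hG : ∀ i, (G i).IsHomogeneous (d i))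
    (hinv : ∀ i, ∀ α : LieModule.Weight K H L, α.IsNonZero → ∀ w : H,
      MvPolynomial.eval (b.repr (w - α w • coroot α)) (G i) =
        MvPolynomial.eval (b.repr w) (G i))
    (hJ : (Matrix.of fun i j => MvPolynomial.pderiv j (G i)).det ≠ 0) :
    H.root.card ≤ 2 * ∑ i, (d i - 1) := by
  classical
  have hinj : Function.Injective (fun α : LieModule.Weight K H L => α.toLinear) := by
    intro α β h
    ext x
    exact LinearMap.congr_fun h x
  rw [← Finset.card_image_of_injective H.root hinj]
  -- The counting bound needs coroots attached to functionals rather than weights; functionals that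
  -- are not weights get the irrelevant value `0`.
  have hco : ∀ f : Dual K H, ∃ c : H, ∀ α : LieModule.Weight K H L, α.toLinear = f →
      c = coroot α := by
    intro f
    by_cases h : ∃ α : LieModule.Weight K H L, α.toLinear = f
    · obtain ⟨α, rfl⟩ := h
      exact ⟨coroot α, fun β hβ => by rw [hinj hβ]⟩
    · exact ⟨0, fun α hα => (h ⟨α, hα⟩).elim⟩
  choose co hco using hco
  refine card_le_two_mul_sum_of_reflection_invariant b _ co ?_ ?_ hG ?_ hJ
  · intro f hf
    obtain ⟨α, hα, rfl⟩ := Finset.mem_image.1 hf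
    rw [hco _ α rfl]
    exact root_apply_coroot (by simpa using hα)
  · intro f hf f' hf' t ht
    obtain ⟨α, hα, rfl⟩ := Finset.mem_image.1 hf
    obtain ⟨β, hβ, rfl⟩ := Finset.mem_image.1 hf'
    rcases eq_neg_or_eq_of_eq_smul α β (by simpa using hβ) t
      (funext fun x => LinearMap.congr_fun ht x) with h | h
    · right
      ext x
      rw [h]
      simp
    · left
      rw [h]
  · intro i f hf w
    obtain ⟨α, hα, rfl⟩ := Finset.mem_image.1 hf
    rw [hco _ α rfl]
    exact hinv i α (by simpa using hα) w

end LieAlgebra.IsKilling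

/-! ### Power traces on a Cartan subalgebra and their Jacobian -/

section GenericTrace

open TensorProduct Module MvPolynomial

variable {K A L ι : Type*} [Field K] [Ring A] [Algebra K A] [LieRing L] [LieAlgebra K L]
  [Fintype ι]

/-- Left multiplication is absorbed into the functional, so homogeneity of `τ (f z ^ m)` can be
proved by induction over all `τ` at once. -/
theorem tensorTrace_tmul_mul {R : Type*} [CommRing R] [Algebra K R] (τ : A →ₗ[K] K) (r : R) (a : A)
    (Y : R ⊗[K] A) : tensorTrace R τ ((r ⊗ₜ a) * Y) =
      r * tensorTrace R (τ ∘ₗ LinearMap.mulLeft K a) Y := by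
  induction Y using TensorProduct.induction_on with
  | zero => simp
  | add Y Y' hY hY' => rw [mul_add, map_add, hY, hY', map_add, mul_add]
  | tmul s c => simp [Algebra.TensorProduct.tmul_mul_tmul]

/-- The polynomial function `z ↦ τ (f z ^ m)`. -/
noncomputable def genericTracePow (b : Basis ι K L) (f : L →ₗ[K] A) (τ : A →ₗ[K] K) (m : ℕ) :
    MvPolynomial ι K :=
  tensorTrace (MvPolynomial ι K) τ (genericElement b f 0 ^ m)

theorem isHomogeneous_genericTracePow (b : Basis ι K L) (f : L →ₗ[K] A) (τ : A →ₗ[K] K) (m : ℕ) :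
    (genericTracePow b f τ m).IsHomogeneous m := by
  induction m generalizing τ with
  | zero =>
    rw [genericTracePow, pow_zero, Algebra.TensorProduct.one_def, tensorTrace_tmul,
      MvPolynomial.smul_eq_C_mul, mul_one]
    exact isHomogeneous_C _ _
  | succ m ih =>
    rw [genericTracePow, pow_succ']
    nth_rewrite 1 [genericElement]
    rw [map_zero f, TensorProduct.tmul_zero, zero_add, Finset.sum_mul, map_sum]
    refine IsHomogeneous.sum _ _ _ fun i _ => ?_
    rw [tensorTrace_tmul_mul, add_comm m]
    exact (isHomogeneous_X K i).mul (ih _)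

theorem eval_genericTracePow (b : Basis ι K L) (f : L →ₗ[K] A) (τ : A →ₗ[K] K) (m : ℕ) (w : L) :
    eval (b.repr w) (genericTracePow b f τ m) = τ (f w ^ m) := by
  rw [← MvPolynomial.aeval_eq_eval, genericTracePow, algHom_tensorTrace,
    map_pow (tensorEval _ _), tensorEval_genericElement, zero_add]

theorem eval_pderiv_genericTracePow [DecidableEq ι] (b : Basis ι K L) (f : L →ₗ[K] A)
    (τ : A →ₗ[K] K) (hτ : ∀ x y, τ (x * y) = τ (y * x)) (m : ℕ) (w : L) (j : ι) :
    eval (b.repr w) (pderiv j (genericTracePow b f τ (m + 1))) =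
      (m + 1 : K) * τ (f w ^ m * f (b j)) := by
  have h1 : (pderiv j : Derivation K (MvPolynomial ι K) (MvPolynomial ι K)).tensor A
      (genericElement b f 0) = 1 ⊗ₜ f (b j) := by
    rw [genericElement, map_add, map_sum, Derivation.tensor_tmul, Derivation.map_one_eq_zero,
      TensorProduct.zero_tmul, zero_add, Finset.sum_eq_single j]
    · simp
    · intro i _ hi
      simp [pderiv_X_of_ne hi]
    · simp
  rw [genericTracePow, Derivation.tensorTrace_pow_succ _ τ hτ, h1, ← MvPolynomial.aeval_eq_eval,
    map_nsmul, algHom_tensorTrace, map_mul, map_pow (tensorEval _ _), tensorEval_genericElement,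
    zero_add, tensorEval_tmul]
  simp

end GenericTrace

namespace LieSubalgebra

open Module

variable {K V : Type*} [Field K] [CharZero K] [IsAlgClosed K] [AddCommGroup V] [Module K V]
  [FiniteDimensional K V] {g : LieSubalgebra K (Module.End K V)} [LieAlgebra.IsSemisimple K g]

/-- The trace form is nondegenerate on Cartan subalgebras. -/
theorem eq_zero_of_forall_mem_cartan_trace_mul_eq_zero (H : LieSubalgebra K g)
    [H.IsCartanSubalgebra] {z : g} (hz : z ∈ H)
    (htr : ∀ w ∈ H, LinearMap.trace K V ((z : Module.End K V) * w) = 0) : z = 0 := by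
  obtain ⟨a, ha⟩ := LieAlgebra.IsKilling.exists_forall_root_apply_ne_zero H
  refine eq_zero_of_forall_trace_mul_eq_zero g z fun u => ?_
  -- By invariance, `⁅g, a⁆` is orthogonal to everything commuting with `a`, hence to `z`; only the
  -- component in `H` can pair with `z`.
  obtain ⟨u', w, hw, rfl⟩ :=
    LieAlgebra.IsKilling.exists_eq_lie_add_of_root_apply_ne_zero H ha u
  have h1 : ⁅(⟨z, hz⟩ : H), a⁆ = 0 := trivial_lie_zero _ _ _ _
  have h2 : (z : Module.End K V) * ((a : g) : Module.End K V) -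
      ((a : g) : Module.End K V) * z = 0 :=
    congrArg (fun t : H => ((t : g) : Module.End K V)) h1
  have h3 : ((⁅u', (a : g)⁆ + w : g) : Module.End K V) =
      (u' : Module.End K V) * ((a : g) : Module.End K V) - ((a : g) : Module.End K V) * u' + w :=
    rfl
  rw [h3, mul_add, map_add, htr w hw, add_zero, mul_sub, map_sub, ← mul_assoc, ← mul_assoc,
    LinearMap.trace_mul_comm, ← mul_assoc, ← sub_eq_zero.1 h2, sub_self]

/-- At `c`, row `s` of the Jacobian is `(E s + 1) tr (p (c ^ E s) b j)`. A relation among the rows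
yields a combination of the `p (c ^ E s)` in `H` orthogonal to `H`, hence zero, against their
independence. -/
theorem jacobian_genericTracePow_ne_zero (H : LieSubalgebra K g) [H.IsCartanSubalgebra]
    {p : Module.End K V →ₗ[K] g}
    (hp : ∀ a (w : g),
      LinearMap.trace K V ((p a : Module.End K V) * w) = LinearMap.trace K V (a * w))
    {ι : Type*} [Fintype ι] [DecidableEq ι] (b : Basis ι K H) (E : ι → ℕ) {c : H}
    (hc : ∀ m : ℕ, p (((c : g) : Module.End K V) ^ m) ∈ H)
    (hli : LinearIndependent K fun s => p (((c : g) : Module.End K V) ^ E s)) :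
    (Matrix.of fun s j => MvPolynomial.pderiv j (genericTracePow b
      (g.toSubmodule.subtype ∘ₗ H.toSubmodule.subtype) (LinearMap.trace K V) (E s + 1))).det ≠ 0 := by
  intro hdet
  have h1 := congrArg (MvPolynomial.eval (b.repr c)) hdet
  rw [map_zero, RingHom.map_det] at h1
  obtain ⟨v, hv0, hv⟩ := Matrix.exists_vecMul_eq_zero_iff.2 h1
  let z : g := ∑ s, (v s * (E s + 1 : K)) • p (((c : g) : Module.End K V) ^ E s)
  have hzH : z ∈ H := H.toSubmodule.sum_mem fun s _ => H.toSubmodule.smul_mem _ (hc _)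
  have hzb : ∀ w : g, LinearMap.trace K V ((z : Module.End K V) * w) =
      ∑ s, v s * ((E s + 1 : K) *
        LinearMap.trace K V (((c : g) : Module.End K V) ^ E s * w)) := by
    intro w
    have h3 : (z : Module.End K V) = ∑ s, (v s * (E s + 1 : K)) •
        (p (((c : g) : Module.End K V) ^ E s) : Module.End K V) := by
      simp [z]
    rw [h3, Finset.sum_mul, map_sum]
    refine Finset.sum_congr rfl fun s _ => ?_
    rw [smul_mul_assoc, map_smul, hp, smul_eq_mul, mul_assoc]
  have hz0 : z = 0 := by
    refine eq_zero_of_forall_mem_cartan_trace_mul_eq_zero H hzH fun w hw => ?_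
    have hb : ∀ j, LinearMap.trace K V ((z : Module.End K V) * ((b j : H) : g)) = 0 := by
      intro j
      rw [hzb]
      refine Eq.trans ?_ (congrFun hv j)
      refine Finset.sum_congr rfl fun s _ => ?_
      congr 1
      simp only [RingHom.mapMatrix_apply, Matrix.map_apply, Matrix.of_apply]
      rw [eval_pderiv_genericTracePow b _ _ fun x y => LinearMap.trace_mul_comm K x y]
      rfl
    have h4 : LinearMap.trace K V ∘ₗ LinearMap.mulLeft K (z : Module.End K V) ∘ₗ
        (g.toSubmodule.subtype ∘ₗ H.toSubmodule.subtype) = 0 := b.ext hb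
    exact LinearMap.congr_fun h4 ⟨w, hw⟩
  refine hv0 (funext fun s => ?_)
  have := Fintype.linearIndependent_iff.1 hli _ hz0 s
  exact (mul_eq_zero.1 this).resolve_right (by exact_mod_cast Nat.succ_ne_zero (E s))

theorem genericTracePow_mem_adjoin (H : LieSubalgebra K g) [H.IsCartanSubalgebra]
    {ι κ : Type*} [Fintype ι] [DecidableEq ι] (b : Basis ι K H)
    {f : κ → SymmetricAlgebra K (Dual K H)}
    (hf : Algebra.adjoin K (Set.range f) =
      (LieAlgebra.IsKilling.rootSystem H).weylInvariants) (m : ℕ) :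
    genericTracePow b (g.toSubmodule.subtype ∘ₗ H.toSubmodule.subtype) (LinearMap.trace K V) m ∈
      Algebra.adjoin K (Set.range fun i =>
        SymmetricAlgebra.equivMvPolynomial b.dualBasis (f i)) := by
  set Ψ := SymmetricAlgebra.equivMvPolynomial b.dualBasis with hΨ
  set F := genericTracePow b (g.toSubmodule.subtype ∘ₗ H.toSubmodule.subtype)
    (LinearMap.trace K V) m with hF
  have hev : ∀ a : H, SymmetricAlgebra.lift (Dual.eval K H a) (Ψ.symm F) =
      LinearMap.trace K V (((a : g) : Module.End K V) ^ m) := by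
    intro a
    rw [← SymmetricAlgebra.eval_equivMvPolynomial_dualBasis b, ← hΨ, AlgEquiv.apply_symm_apply, hF,
      eval_genericTracePow]
    rfl
  have h1 : Ψ.symm F ∈ Algebra.adjoin K (Set.range f) := by
    rw [hf, LieAlgebra.IsKilling.mem_weylInvariants_rootSystem_iff]
    intro α hα a
    rw [hev, hev]
    exact trace_pow_sub_smul_coroot H hα a m
  have h2 : Set.range (fun i => Ψ (f i)) = Ψ.toAlgHom '' Set.range f := by
    rw [← Set.range_comp]
    rfl
  rw [h2, ← AlgHom.map_adjoin]
  exact ⟨Ψ.symm F, h1, Ψ.apply_symm_apply F⟩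

end LieSubalgebra

/-! ### Identification of the exponents and conclusion -/

namespace IsCyclicSl2

open Module

variable {K V : Type*} [Field K] [CharZero K] [IsAlgClosed K] [AddCommGroup V] [Module K V]
  [FiniteDimensional K V] {g : LieSubalgebra K (Module.End K V)} [LieAlgebra.IsSemisimple K g]
  {d : ℕ} {e : Basis (Fin (d + 1)) K V} {v : V} {x h y : Module.End K V}

/-- The exponents of a Lie algebra of trace zero endomorphisms of `V` that contains the powers
`x ^ r`, for `r` in `powExponents g x d`, of a single nilpotent Jordan block `x` of size `d + 1`
are these `r`, each with multiplicity one. -/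
theorem exists_equiv_powExponents (T : IsCyclicSl2 g e v x h y) (hd : d ≠ 0)
    (hsl : ∀ a ∈ g, LinearMap.trace K V a = 0) (H : LieSubalgebra K g) [H.IsCartanSubalgebra]
    {n : ℕ} {r : Fin n → ℕ} (hr : (LieAlgebra.IsKilling.rootSystem H).IsExponents r) :
    ∃ E : Fin n ≃ powExponents g x d, ∀ i, r i = E i := by
  obtain ⟨hn, f, -, hfr, hf⟩ := hr
  rw [Subspace.dual_finrank_eq] at hn
  obtain ⟨p, hp⟩ := LieSubalgebra.exists_projection g
  obtain ⟨hcard, c, hc, hli⟩ := T.exists_linearIndependent_projection_pow hd hsl hp H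
  let b : Basis (Fin n) K H := Module.finBasisOfFinrankEq K H hn.symm
  have hcard' : Fintype.card (Fin n) = Fintype.card (powExponents g x d) := by
    rw [Fintype.card_fin, Fintype.card_coe, hcard, hn]
  let E : Fin n ≃ powExponents g x d := Fintype.equivOfCardEq hcard'
  have hJF := LieSubalgebra.jacobian_genericTracePow_ne_zero H hp b (fun s => (E s : ℕ)) hc
    (hli.comp E E.injective)
  have hG : ∀ i, (SymmetricAlgebra.equivMvPolynomial b.dualBasis (f i)).IsHomogeneous (r i + 1) :=
    fun i => SymmetricAlgebra.isHomogeneous_equivMvPolynomial b.dualBasis (hfr i)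
  obtain ⟨hJG, σ, hσ⟩ := MvPolynomial.exists_perm_le_of_jacobian_ne_zero hG
    (fun s => isHomogeneous_genericTracePow b _ _ ((E s : ℕ) + 1))
    (fun s => LieSubalgebra.genericTracePow_mem_adjoin H b hf _) hJF
  have hroots : H.root.card ≤ 2 * ∑ i, r i := by
    refine LieAlgebra.IsKilling.card_root_le_two_mul_sum H b hG (fun i α hα w => ?_) hJG
    rw [SymmetricAlgebra.eval_equivMvPolynomial_dualBasis,
      SymmetricAlgebra.eval_equivMvPolynomial_dualBasis]
    refine (LieAlgebra.IsKilling.mem_weylInvariants_rootSystem_iff H (f i)).1 ?_ α hα w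
    rw [← hf]
    exact Algebra.subset_adjoin ⟨i, rfl⟩
  have hsum := T.sum_powExponents_le_finrank hd
  have hdim := LieAlgebra.IsKilling.finrank_le_finrank_cartan_add_card_root H
  have h1 : ∑ r ∈ powExponents g x d, (2 * r + 1) = 2 * ∑ s, (E s : ℕ) + n := by
    rw [← Finset.sum_coe_sort, ← E.sum_comp, Finset.sum_add_distrib, ← Finset.mul_sum]
    simp
  -- The dimension squeeze: `2 ∑ E s + n ≤ dim g ≤ n + |Φ| ≤ n + 2 ∑ r i`. Together with `r (σ s) ≤
  -- E s` it forces equality term by term.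
  have h2 : ∑ s, (E s : ℕ) ≤ ∑ s, r (σ s) := by
    rw [Equiv.sum_comp σ r]
    omega
  have h3 : ∀ s, r (σ s) = E s := by
    have h4 : ∀ s ∈ Finset.univ, r (σ s) ≤ E s := fun s _ => by
      have := hσ s
      omega
    intro s
    exact (Finset.sum_eq_sum_iff_of_le h4).1 (le_antisymm (Finset.sum_le_sum h4) h2) s
      (Finset.mem_univ s)
  refine ⟨σ.symm.trans E, fun i => ?_⟩
  rw [Equiv.trans_apply, ← h3, Equiv.apply_symm_apply]

end IsCyclicSl2

theorem lemma6 {K : Type*} [Field K] [CharZero K] [IsAlgClosed K]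
    {V : Type*} [AddCommGroup V] [Module K V] [FiniteDimensional K V]
    (k : ℕ) (hk : Module.finrank K V = k)
    (g : LieSubalgebra K (Module.End K V)) [LieAlgebra.IsSemisimple K g]
    (hsl : ∀ a ∈ g, LinearMap.trace K V a = 0)
    (hx : ∃ x ∈ g, IsSingleNilpotentJordanBlock x)
    (H : LieSubalgebra K g) [H.IsCartanSubalgebra]
    {n : ℕ} (r : Fin n → ℕ) (hr : (LieAlgebra.IsKilling.rootSystem H).IsExponents r) :
    (Function.Injective r ∧ ∀ i, r i ≤ k - 1) ∧
    (∀ i j, r i + r j ≤ k → ∃ l, r l = r i + r j - 1) := by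
  obtain ⟨x, hxg, hxJ⟩ := hx
  obtain ⟨d, u, hd, hx1, hxu⟩ := hxJ.exists_pow
  rw [hk] at hd
  subst hd
  -- If `dim V = 1`, the trace condition gives `g = 0` and there are no exponents; this case is
  -- separate because the `sl₂`-triple would then be zero.
  rcases Nat.eq_zero_or_pos d with rfl | hd
  · have hg : ∀ a : g, a = 0 := by
      intro a
      have h1 : ∀ t : Module.End K V, LinearMap.trace K V t = 0 → t = 0 := by
        intro t ht
        obtain ⟨c, hc⟩ := (LinearMap.existsUnique_eq_smul_id_of_finrank_eq_one
          (R := K) (M := V) (by simpa using hk) t).exists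
        rw [hc, map_smul, LinearMap.trace_id, hk] at ht
        have h2 : c = 0 := by simpa using ht
        rw [hc, h2, zero_smul]
      exact Subtype.ext (h1 _ (hsl _ a.2))
    have hn : n = 0 := by
      have : Subsingleton H := ⟨fun a b => Subtype.ext ((hg a).trans (hg b).symm)⟩
      rw [hr.1, Subspace.dual_finrank_eq, Module.finrank_zero_of_subsingleton]
    subst hn
    exact ⟨⟨fun i => i.elim0, fun i => i.elim0⟩, fun i => i.elim0⟩
  · obtain ⟨v, e, h, y, he, hh, hy, hhp, hhx, hxy, hhy⟩ :=
      LieSubalgebra.exists_sl2_of_pow hsl hxg hk hx1 hxu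
    have T : IsCyclicSl2 g e v x h y := ⟨he, hx1, hxg, hh, hy, hhp, hhx, hxy, hhy⟩
    obtain ⟨E, hE⟩ := T.exists_equiv_powExponents hd.ne' hsl H hr
    refine ⟨⟨fun i j hij => E.injective (Subtype.ext ?_), fun i => ?_⟩, fun i j hij => ?_⟩
    · rw [← hE, ← hE, hij]
    · rw [hE, Nat.add_sub_cancel]
      exact (mem_powExponents.1 (E i).2).2.1
    · rw [hE, hE] at hij ⊢
      refine ⟨E.symm ⟨_, T.add_sub_one_mem_powExponents (E i).2 (E j).2 hij⟩, ?_⟩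
      rw [hE, Equiv.apply_symm_apply]
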